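/- Let $\mathcal{X}\subseteq\mathbb{R}^d$ be a measurable data domain and let $0<\gamma$. An *output distribution* is a measurable function $F:\mathcal{X}\to[\gamma,1]$ with $\int_{\mathcal{X}}F(x)\,dx=1$. For output distributions $f,g$ put $$d_{\mathcal P}(f,g)=\int_{\mathcal{X}} f(x)\log\frac{f(x)}{g(x)}\,dx ,\qquad \hat d_{\mathcal P}(f,g)=\sum_{i=1}^n f(x_i)\log\frac{f(x_i)}{g(x_i)},$$ where $x_1,\dots,x_n$ ($n\ge 1$) are i.i.d. samples drawn uniformly from $\mathcal{X}$. Let the labeling function $F^\star$ and the weak model $F_w$ be output distributions, let $h_s:\mathcal{X}\to\mathbb{R}^{d_s}$ be the strong representation, and let $\mathcal{F}_s$ be a convex set of functions on $\mathbb{R}^{d_s}$ such that $f\circ h_s$ is an output distribution for every $f\in\mathcal{F}_s$. Let $\mathcal{C}_{\mathcal{F}_s}$ be the pseudo-dimension of $\mathcal{F}_s$, i.e. the largest cardinality of a finite set $S$ of points for which there are thresholds $(r_z)_{z\in S}$ such that for every $T\subseteq S$ some $f\in\mathcal{F}_s$ satisfies $f(z)\ge r_z \Leftrightarrow z\in T$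 for all $z\in S$; assume that it is finite. Let $$f_s\in\operatorname*{argmin}_{f\in\mathcal{F}_s} d_{\mathcal P}(F^\star,f\circ h_s),\quad f_{sw}\in\operatorname*{argmin}_{f\in\mathcal{F}_s} d_{\mathcal P}(F_w,f\circ h_s),\quad \hat f_{sw}\in\operatorname*{argmin}_{f\in\mathcal{F}_s}\hat d_{\mathcal P}(F_w,f\circ h_s),$$ write $F_s=f_s\circ h_s$, $F_{sw}=f_{sw}\circ h_s$, $\hat F_{sw}=\hat f_{sw}\circ h_s$, and let $\varepsilon=d_{\mathcal P}(F_s,F^\star)$. Assume that the weighted Itakura–Saito divergence with weight $w=F_{sw}-F_w$ satisfies $$\mathrm{D}_{\mathrm{WIS}}(F^\star\|F_{sw})=\int_{\mathcal{X}}\bigl(F_{sw}(x)-F_w(x)\bigr)\Bigl(\frac{F^\star(x)}{F_{sw}(x)}-\log\frac{F^\star(x)}{F_{sw}(x)}-1\Bigr)dx\le 0 .$$ Then there is a constant $K>0$ depending only on $\gamma$ such that for every $n\ge1$ and every $\delta\in(0,1)$, with probability at least $1-\delta$ over the draw of the $n$ samples, every empirical minimizer $\hat f_{sw}$ satisfies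 $$d_{\mathcal P}(\hat F_{sw},F^\star)\le d_{\mathcal P}(F_w,F^\star)-d_{\mathcal P}(F_w,\hat F_{sw})+K\sqrt{\varepsilon}+K\sqrt{\frac{\mathcal{C}_{\mathcal{F}_s}}{n}}+K\sqrt{\frac{\log(1/\delta)}{n}} .$$ -/

import Mathlib

noncomputable section

open MeasureTheory

namespace WeakToStrong

/-- `F` is (the density of) an output distribution on the data domain `X`, with values in the
output domain `[γ, 1]`: the outputs over `X` are normalized to total mass one. -/
structure IsOutputDistribution {d : ℕ} (X : Set (EuclideanSpace ℝ (Fin d))) (γ : ℝ)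
    (F : EuclideanSpace ℝ (Fin d) → ℝ) : Prop where
  aemeasurable : AEMeasurable F (volume.restrict X)
  mem_range : ∀ x ∈ X, F x ∈ Set.Icc γ 1
  normalized : ∫ x in X, F x = 1

/-- The output distribution divergence `∫_X f log (f / g) dx`. -/
def outputDivergence {d : ℕ} (X : Set (EuclideanSpace ℝ (Fin d)))
    (f g : EuclideanSpace ℝ (Fin d) → ℝ) : ℝ :=
  ∫ x in X, f x * Real.log (f x / g x)

/-- The empirical output distribution divergence `∑ i, f(xᵢ) log (f(xᵢ) / g(xᵢ))`. -/
def empiricalDivergence {d n : ℕ} (x : Fin n → EuclideanSpace ℝ (Fin d))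
    (f g : EuclideanSpace ℝ (Fin d) → ℝ) : ℝ :=
  ∑ i, f (x i) * Real.log (f (x i) / g (x i))

/-- The weighted Itakura–Saito divergence of `P` and `Q` on `X`, with weight function `w`. -/
def weightedItakuraSaito {d : ℕ} (X : Set (EuclideanSpace ℝ (Fin d)))
    (w P Q : EuclideanSpace ℝ (Fin d) → ℝ) : ℝ :=
  ∫ x in X, w x * (P x / Q x - Real.log (P x / Q x) - 1)

/-- `f` is an element of `argmin_{g ∈ 𝓕} L g`. -/
def IsArgmin {α : Type*} (𝓕 : Set α) (L : α → ℝ) (f : α) : Prop :=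
  f ∈ 𝓕 ∧ ∀ g ∈ 𝓕, L f ≤ L g

/-- A class of real functions pseudo-shatters a finite set of points if, for suitable thresholds,
every subset of the points is cut out by a function of the class exceeding its threshold. -/
def PseudoShatters {α : Type*} (𝓕 : Set (α → ℝ)) (s : Finset α) : Prop :=
  ∃ r : α → ℝ, ∀ t ⊆ s, ∃ f ∈ 𝓕, ∀ x ∈ s, (r x ≤ f x ↔ x ∈ t)

/-- The pseudo-dimension (Pollard dimension) of a class of real functions: the supremum of the
cardinalities of the finite sets that the class pseudo-shatters. -/
def pseudoDimension {α : Type*} (𝓕 : Set (α → ℝ)) : ℕ∞ :=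
  ⨆ s : {s : Finset α // PseudoShatters 𝓕 s}, ((s : Finset α).card : ℕ∞)

/-- The law of `n` i.i.d. samples drawn uniformly from `X`. -/
def sampleLaw {d : ℕ} (X : Set (EuclideanSpace ℝ (Fin d))) (n : ℕ) :
    Measure (Fin n → EuclideanSpace ℝ (Fin d)) :=
  Measure.pi fun _ => ProbabilityTheory.cond volume X

end WeakToStrong

end

/-! Write `q`, `w`, `p`, `s`, `f` for F_sw, F_w, F*, F_s and the empirical minimizer. The theorem
combines a population inequality for `q` with an L¹ bound on `f - q`.

Population. Pointwise, `q log(q/p) + w log(w/q) - w log(w/p)` equals the Itakura–Saito integrand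
plus `(q - p) + (w/q)(p - q)`. The first part integrates to something nonpositive by hypothesis, and
`q - p` integrates to zero because both masses are one. Split `p - q = (s - q) + (p - s)`:
first-order optimality of `q` over the convex class makes the integral of `(w/q)(s - q)`
nonpositive, and the remainder is at most `‖s - p‖₁ / γ`, of order `√ε` by a Pinsker inequality
(`IsDensity.pythagorean_le`).

Sampling. The sum `d(f, p) + d(w, f)` changes by at most `2/γ` times `‖f - q‖₁`, so that norm must
be of order `√((C + log(1/δ))/n)`. A uniform bound on the excess risk followed by strong convexity
would give only the square root of this rate, hence the localized argument of
`exists_integral_abs_sub_le`. A convex class of pseudo-dimension `C` has affine dimension at most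
`C`, so `f - q` ranges over a linear space of that dimension. Strong convexity and the two
optimality conditions bound the empirical second moment of `f - q` by the deviation of a linear
functional of it. Nets and a Bernstein bound control linear and quadratic deviations relative to the
size of the function, and the resulting quadratic inequality in `‖f - q‖₂` gives the rate.

Constants depend on `γ` alone, since values in `[γ, 1]` and unit mass force the volume of `X` into
`[1, 1/γ]`. -/

open MeasureTheory

namespace WeakToStrong

/-! ### Nets for seminorm balls, and forms controlled on a net -/

/-- Volume bound for separated subsets of the unit ball. -/
theorem card_le_of_eighth_separated {E : Type*} [NormedAddCommGroup E] [NormedSpace ℝ E]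
    [FiniteDimensional ℝ E] (s : Finset E) (hs : ∀ c ∈ s, ‖c‖ ≤ 1)
    (h : ∀ c ∈ s, ∀ d ∈ s, c ≠ d → 1 / 8 ≤ ‖c - d‖) :
    s.card ≤ 17 ^ Module.finrank ℝ E := by
  borelize E
  let μ : Measure E := Measure.addHaar
  let δ : ℝ := (1 : ℝ) / 16
  let ρ : ℝ := (17 : ℝ) / 16
  have ρpos : 0 < ρ := by norm_num [ρ]
  -- Balls of radius 1/16 around the points are disjoint and lie in the ball of radius 17/16; the
  -- ratio of the radii is 17.
  set A := ⋃ c ∈ s, Metric.ball (c : E) δ with hA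
  have D : Set.Pairwise (s : Set E) (Function.onFun Disjoint fun c => Metric.ball (c : E) δ) := by
    rintro c hc d hd hcd
    apply Metric.ball_disjoint_ball
    rw [dist_eq_norm]
    refine le_trans (le_of_eq ?_) (h c hc d hd hcd)
    norm_num [δ]
  have A_subset : A ⊆ Metric.ball (0 : E) ρ := by
    refine Set.iUnion₂_subset fun x hx => ?_
    apply Metric.ball_subset_ball'
    calc
      δ + dist x 0 ≤ δ + 1 := by rw [dist_zero_right]; exact add_le_add le_rfl (hs x hx)
      _ = ρ := by norm_num [δ, ρ]
  have I : (s.card : ENNReal) * ENNReal.ofReal (δ ^ Module.finrank ℝ E) * μ (Metric.ball 0 1) ≤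
      ENNReal.ofReal (ρ ^ Module.finrank ℝ E) * μ (Metric.ball 0 1) :=
    calc
      (s.card : ENNReal) * ENNReal.ofReal (δ ^ Module.finrank ℝ E) * μ (Metric.ball 0 1)
          = μ A := by
        rw [hA, measure_biUnion_finset D fun c _ => measurableSet_ball]
        have I : 0 < δ := by norm_num [δ]
        simp only [μ.addHaar_ball_of_pos _ I]
        simp only [Finset.sum_const, nsmul_eq_mul, mul_assoc]
      _ ≤ μ (Metric.ball (0 : E) ρ) := measure_mono A_subset
      _ = ENNReal.ofReal (ρ ^ Module.finrank ℝ E) * μ (Metric.ball 0 1) := by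
        simp only [μ.addHaar_ball_of_pos _ ρpos]
  have J : (s.card : ENNReal) * ENNReal.ofReal (δ ^ Module.finrank ℝ E) ≤
      ENNReal.ofReal (ρ ^ Module.finrank ℝ E) :=
    (ENNReal.mul_le_mul_iff_left (Metric.measure_ball_pos _ _ zero_lt_one).ne'
      measure_ball_lt_top.ne).1 I
  have K : (s.card : ℝ) ≤ (17 : ℝ) ^ Module.finrank ℝ E := by
    have h1 := ENNReal.toReal_le_of_le_ofReal (pow_nonneg ρpos.le _) J
    have h2 : (0 : ℝ) ≤ δ ^ Module.finrank ℝ E := by positivity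
    rw [ENNReal.toReal_mul, ENNReal.toReal_natCast, ENNReal.toReal_ofReal h2] at h1
    have h3 : ρ ^ Module.finrank ℝ E = 17 ^ Module.finrank ℝ E * δ ^ Module.finrank ℝ E := by
      rw [← mul_pow]; norm_num [ρ, δ]
    rw [h3] at h1
    exact le_of_mul_le_mul_right h1 (by positivity)
  exact mod_cast K

/-- A 1/8-separated subset of the unit ball of maximal cardinality is a net, since a point it missed
could be added. The volume bound makes the maximum exist. -/
theorem exists_eighth_net_of_normed {E : Type*} [NormedAddCommGroup E] [NormedSpace ℝ E]
    [FiniteDimensional ℝ E] :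
    ∃ T : Finset E, T.card ≤ 17 ^ Module.finrank ℝ E ∧ (∀ w ∈ T, ‖w‖ ≤ 1) ∧
      ∀ v : E, ‖v‖ ≤ 1 → ∃ w ∈ T, ‖v - w‖ ≤ 1 / 8 := by
  classical
  let p : ℕ → Prop := fun m => ∃ s : Finset E, s.card = m ∧ (∀ c ∈ s, ‖c‖ ≤ 1) ∧
    (∀ c ∈ s, ∀ d ∈ s, c ≠ d → 1 / 8 ≤ ‖c - d‖)
  have hb : ∀ m, p m → m ≤ 17 ^ Module.finrank ℝ E := by
    rintro m ⟨s, rfl, h1, h2⟩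
    exact card_le_of_eighth_separated s h1 h2
  have h0 : p 0 := ⟨∅, by simp⟩
  have hmax := Nat.findGreatest_spec (P := p) (Nat.zero_le (17 ^ Module.finrank ℝ E)) h0
  obtain ⟨s, hcard, h1, h2⟩ := hmax
  refine ⟨s, card_le_of_eighth_separated s h1 h2, h1, fun v hv => ?_⟩
  by_contra! hcon
  have hvs : v ∉ s := fun hvs => by
    have := hcon v hvs
    norm_num at this
  have hp : p (s.card + 1) := by
    refine ⟨insert v s, Finset.card_insert_of_notMem hvs, ?_, ?_⟩
    · intro c hc
      rcases Finset.mem_insert.1 hc with rfl | hc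
      exacts [hv, h1 c hc]
    · intro c hc d hd hcd
      rcases Finset.mem_insert.1 hc with rfl | hc' <;> rcases Finset.mem_insert.1 hd with rfl | hd'
      · exact absurd rfl hcd
      · exact (hcon d hd').le
      · rw [norm_sub_rev]; exact (hcon c hc').le
      · exact h2 c hc' d hd' hcd
  have := Nat.le_findGreatest (hb _ hp) hp
  omega

/-- The unit ball of a seminorm on a `k`-dimensional space has a `1/8`-net of size `17 ^ k`. -/
theorem exists_eighth_net {E : Type*} [AddCommGroup E] [Module ℝ E] [FiniteDimensional ℝ E]
    (p : Seminorm ℝ E) :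
    ∃ T : Finset E, T.card ≤ 17 ^ Module.finrank ℝ E ∧ (∀ w ∈ T, p w ≤ 1) ∧
      ∀ v : E, p v ≤ 1 → ∃ w ∈ T, p (v - w) ≤ 1 / 8 := by
  classical
  let : SeminormedAddCommGroup E := p.toAddGroupSeminorm.toSeminormedAddCommGroup
  have hn : ∀ v : E, ‖v‖ = p v := fun _ => rfl
  let : NormedSpace ℝ E := ⟨fun a b => by rw [hn, hn, map_smul_eq_mul]⟩
  -- The seminorm may have a kernel; quotienting it out gives a normed space of no larger dimension,
  -- whose net is lifted by a section.
  let π : E →ₗ[ℝ] SeparationQuotient E := (SeparationQuotient.mkCLM ℝ E).toLinearMap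
  have hπn : ∀ v, ‖π v‖ = p v := fun v => SeparationQuotient.norm_mk v
  have hπ : Function.Surjective π := SeparationQuotient.surjective_mk
  have : FiniteDimensional ℝ (SeparationQuotient E) := Module.Finite.of_surjective π hπ
  obtain ⟨T, hT, hT1, hT2⟩ := exists_eighth_net_of_normed (E := SeparationQuotient E)
  obtain ⟨σ, hσ⟩ := hπ.hasRightInverse
  refine ⟨T.image σ, ?_, ?_, ?_⟩
  · refine Finset.card_image_le.trans (hT.trans ?_)
    exact Nat.pow_le_pow_right (by norm_num) (LinearMap.finrank_le_finrank_of_surjective hπ)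
  · intro w hw
    obtain ⟨u, hu, rfl⟩ := Finset.mem_image.1 hw
    rw [← hπn, hσ]; exact hT1 u hu
  · intro v hv
    obtain ⟨u, hu, huv⟩ := hT2 (π v) (by rw [hπn]; exact hv)
    refine ⟨σ u, Finset.mem_image_of_mem _ hu, ?_⟩
    rw [← hπn, map_sub, hσ]; exact huv

/-- Homogeneity rescales to the unit ball when `p v` is positive. The crude bound `B` serves only to
make `q` vanish where `p` does; it does not reach the conclusion. -/
theorem abs_le_of_bounded_of_le_on_ball {E : Type*} [AddCommGroup E] [Module ℝ E]
    (p : Seminorm ℝ E) (m : ℕ) (q : E → ℝ) (hq : ∀ (a : ℝ) v, q (a • v) = a ^ m * q v)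
    {B S : ℝ} (hB : ∀ v, |q v| ≤ B * p v ^ m) (hm : m ≠ 0)
    (hS : ∀ v, p v ≤ 1 → |q v| ≤ S) (v : E) : |q v| ≤ S * p v ^ m := by
  rcases (apply_nonneg p v).eq_or_lt with h | h
  · have := hB v
    rw [← h, zero_pow hm, mul_zero] at this ⊢
    exact this
  · have h1 := hS ((p v)⁻¹ • v) (by
      rw [map_smul_eq_mul, Real.norm_eq_abs, abs_of_pos (inv_pos.2 h), inv_mul_cancel₀ h.ne'])
    rw [hq, abs_mul, abs_of_pos (by positivity), inv_pow, inv_mul_le_iff₀ (by positivity)] at h1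
    linarith

/-- A linear form is controlled by its values on a net. -/
theorem abs_linear_le_of_net {E : Type*} [AddCommGroup E] [Module ℝ E] (p : Seminorm ℝ E)
    {T : Finset E} (hT : ∀ v : E, p v ≤ 1 → ∃ w ∈ T, p (v - w) ≤ 1 / 8)
    (ℓ : E →ₗ[ℝ] ℝ) {B M : ℝ} (hB : ∀ v, |ℓ v| ≤ B * p v) (hM : ∀ w ∈ T, |ℓ w| ≤ M) (v : E) :
    |ℓ v| ≤ 2 * M * p v := by
  have hB' : ∀ v, |ℓ v| ≤ B * p v ^ 1 := by simpa using hB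
  have hq : ∀ (a : ℝ) v, ℓ (a • v) = a ^ 1 * ℓ v := by simp
  let V : Set ℝ := {r | ∃ v, p v ≤ 1 ∧ r = |ℓ v|}
  have hV : BddAbove V := by
    refine ⟨|B|, ?_⟩
    rintro _ ⟨v, hv, rfl⟩
    refine (hB v).trans ?_
    nlinarith [le_abs_self B, abs_nonneg B, apply_nonneg p v]
  have hV0 : V.Nonempty := ⟨_, 0, by simp, rfl⟩
  have hS : ∀ v, p v ≤ 1 → |ℓ v| ≤ sSup V := fun v hv => le_csSup hV ⟨v, hv, rfl⟩
  have hS' := abs_le_of_bounded_of_le_on_ball p 1 ℓ hq hB' one_ne_zero hS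
  have hS0 : 0 ≤ sSup V := (abs_nonneg _).trans (hS 0 (by simp))
  -- The supremum over the ball is bounded by the net plus an eighth of itself; it is finite thanks
  -- to `B`, so it can be absorbed.
  have hle : sSup V ≤ M + sSup V / 8 := by
    refine csSup_le hV0 ?_
    rintro _ ⟨v, hv, rfl⟩
    obtain ⟨w, hw, hvw⟩ := hT v hv
    have h1 := hS' (v - w)
    have h2 := hM w hw
    rw [map_sub] at h1
    have h3 := abs_sub_abs_le_abs_sub (ℓ v) (ℓ w)
    nlinarith
  have h4 := hS' v
  have := apply_nonneg p v
  nlinarith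

/-- A quadratic form is controlled by its values on a net. -/
theorem abs_quadratic_le_of_net {E : Type*} [AddCommGroup E] [Module ℝ E] (p : Seminorm ℝ E)
    {T : Finset E} (hT1 : ∀ w ∈ T, p w ≤ 1)
    (hT : ∀ v : E, p v ≤ 1 → ∃ w ∈ T, p (v - w) ≤ 1 / 8)
    (β : E →ₗ[ℝ] E →ₗ[ℝ] ℝ) (hβ : ∀ u v, β u v = β v u) {B M : ℝ}
    (hB : ∀ v, |β v v| ≤ B * p v ^ 2) (hM : ∀ w ∈ T, |β w w| ≤ M) (v : E) :
    |β v v| ≤ 2 * M * p v ^ 2 := by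
  have hq : ∀ (a : ℝ) v, β (a • v) (a • v) = a ^ 2 * β v v := by
    intro a v; simp; ring
  let V : Set ℝ := {r | ∃ v, p v ≤ 1 ∧ r = |β v v|}
  have hV : BddAbove V := by
    refine ⟨|B|, ?_⟩
    rintro _ ⟨v, hv, rfl⟩
    refine (hB v).trans ?_
    have : p v ^ 2 ≤ 1 := pow_le_one₀ (apply_nonneg p v) hv
    nlinarith [le_abs_self B, abs_nonneg B, sq_nonneg (p v)]
  have hV0 : V.Nonempty := ⟨_, 0, by simp, rfl⟩
  have hS : ∀ v, p v ≤ 1 → |β v v| ≤ sSup V := fun v hv => le_csSup hV ⟨v, hv, rfl⟩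
  have hS' := abs_le_of_bounded_of_le_on_ball p 2 (fun v => β v v) hq hB two_ne_zero hS
  have hS0 : 0 ≤ sSup V := (abs_nonneg _).trans (hS 0 (by simp))
  have hpol : ∀ u v, p u ≤ 1 → p v ≤ 1 → |β u v| ≤ 2 * sSup V := by
    intro u v hu hv
    have h1 : 4 * β u v = β (u + v) (u + v) - β (u - v) (u - v) := by
      simp [hβ v u]; ring
    have h2 : |β (u + v) (u + v)| ≤ sSup V * 4 := by
      refine (hS' (u + v)).trans (mul_le_mul_of_nonneg_left ?_ hS0)
      have := map_add_le_add p u v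
      nlinarith [apply_nonneg p (u + v)]
    have h3 : |β (u - v) (u - v)| ≤ sSup V * 4 := by
      refine (hS' (u - v)).trans (mul_le_mul_of_nonneg_left ?_ hS0)
      have := map_sub_le_add p u v
      nlinarith [apply_nonneg p (u - v)]
    rw [abs_le] at h2 h3 ⊢
    constructor <;> linarith
  have hle : sSup V ≤ M + sSup V / 2 := by
    refine csSup_le hV0 ?_
    rintro _ ⟨v, hv, rfl⟩
    obtain ⟨w, hw, hvw⟩ := hT v hv
    have h2 := hM w hw
    -- The difference of squares is `β (v - w) (v + w)`. Both arguments are rescaled into the unit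
    -- ball, where polarization bounds `β` by twice the supremum, leaving half of it to absorb.
    have h3 : β v v - β w w = 1 / 4 * β ((8 : ℝ) • (v - w)) ((1 / 2 : ℝ) • (v + w)) := by
      simp [hβ w v]; ring
    have h4 := hpol ((8 : ℝ) • (v - w)) ((1 / 2 : ℝ) • (v + w))
      (by rw [map_smul_eq_mul]; norm_num; linarith)
      (by rw [map_smul_eq_mul]; norm_num; linarith [map_add_le_add p v w, hT1 w hw])
    have h5 := abs_sub_abs_le_abs_sub (β v v) (β w w)
    rw [h3, abs_mul] at h5
    norm_num at h5
    norm_num at h4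
    linarith
  have h4 := hS' v
  have := sq_nonneg (p v)
  nlinarith

/-! ### Affine dimension of a convex class and its pseudo-dimension -/

/-- On a finite-dimensional space of functions, as many point evaluations as the dimension
determine the function and can be prescribed. -/
theorem exists_interpolation_points {α : Type*} (U : Submodule ℝ (α → ℝ)) [FiniteDimensional ℝ U] :
    ∃ s : Finset α, s.card = Module.finrank ℝ U ∧
      ∀ y : α → ℝ, ∃ u ∈ U, ∀ z ∈ s, u z = y z := by
  classical
  let ev : α → Module.Dual ℝ U := fun z => (LinearMap.proj z).comp U.subtype
  -- Choose points whose evaluations form a basis of the span of all evaluations. They separate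
  -- functions, and independence bounds their number by the dimension, so restriction to them is
  -- bijective.
  obtain ⟨κ, a, ha, hspan, hli⟩ := exists_linearIndependent' ℝ ev
  have : Finite κ := Cardinal.lt_aleph0_iff_finite.1 hli.lt_aleph0_of_finite
  have : Fintype κ := Fintype.ofFinite κ
  have hinj : ∀ u : U, (∀ i, (u : α → ℝ) (a i) = 0) → u = 0 := by
    intro u hu
    have h1 : Submodule.span ℝ (Set.range (ev ∘ a)) ≤ LinearMap.ker (Module.Dual.eval ℝ U u) := by
      rw [Submodule.span_le]
      rintro _ ⟨i, rfl⟩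
      exact hu i
    rw [hspan] at h1
    ext z
    exact h1 (Submodule.subset_span ⟨z, rfl⟩)
  let R : U →ₗ[ℝ] (κ → ℝ) := LinearMap.pi fun i => ev (a i)
  have hR : Function.Injective R := by
    rw [injective_iff_map_eq_zero]
    exact fun u hu => hinj u fun i => congrFun hu i
  have hcard : Module.finrank ℝ U = Module.finrank ℝ (κ → ℝ) := by
    refine le_antisymm (LinearMap.finrank_le_finrank_of_injective hR) ?_
    rw [Module.finrank_fintype_fun_eq_card, ← Subspace.dual_finrank_eq]
    exact hli.fintype_card_le_finrank
  have hsurj : Function.Surjective R :=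
    (LinearMap.injective_iff_surjective_of_finrank_eq_finrank hcard).1 hR
  refine ⟨Finset.univ.image a, ?_, fun y => ?_⟩
  · rw [Finset.card_image_of_injective _ ha, hcard, Module.finrank_fintype_fun_eq_card,
      Finset.card_univ]
  · obtain ⟨u, hu⟩ := hsurj fun i => y (a i)
    refine ⟨u, u.2, fun z hz => ?_⟩
    obtain ⟨i, -, rfl⟩ := Finset.mem_image.1 hz
    exact congrFun hu i

/-- The barycentre of finitely many points of a convex set can be moved inside the set in every
direction spanned by the points. -/
theorem exists_pos_barycentre_add_smul_mem {V ι : Type*} [AddCommGroup V] [Module ℝ V] [Fintype ι]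
    {s : Set V} (hs : Convex ℝ s) {x₀ : V} (h₀ : x₀ ∈ s) {x : ι → V} (hx : ∀ i, x i ∈ s)
    {u : V} (hu : u ∈ Submodule.span ℝ (Set.range fun i => x i - x₀)) :
    ∃ η : ℝ, 0 < η ∧
      ((Fintype.card ι + 1 : ℝ)⁻¹ • (x₀ + ∑ i, x i)) + η • u ∈ s := by
  classical
  obtain ⟨c, rfl⟩ := (Submodule.mem_span_range_iff_exists_fun ℝ).1 hu
  set N : ℝ := Fintype.card ι + 1 with hN
  have hN0 : 0 < N := by positivity
  set D : ℝ := 1 + ∑ i, |c i| with hD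
  have hD0 : 0 < D := by positivity
  have hc : ∀ i, |c i| ≤ D := fun i => by
    have := Finset.single_le_sum (f := fun i => |c i|) (fun i _ => abs_nonneg _)
      (Finset.mem_univ i)
    linarith
  have hcs : |∑ i, c i| ≤ D := by
    have := Finset.abs_sum_le_sum_abs c Finset.univ
    linarith
  -- As `D` dominates every `|c i|` and `|∑ c i|`, this `η` alters each barycentric weight by at
  -- most `N⁻¹`, so all weights stay nonnegative.
  set η : ℝ := N⁻¹ * D⁻¹ with hη
  have hηD : η * D = N⁻¹ := by rw [hη, mul_assoc, inv_mul_cancel₀ hD0.ne', mul_one]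
  have hη0 : 0 < η := by positivity
  refine ⟨η, hη0, ?_⟩
  let w : Option ι → ℝ := fun o => o.elim (N⁻¹ - η * ∑ i, c i) fun i => N⁻¹ + η * c i
  let z : Option ι → V := fun o => o.elim x₀ x
  have hz : ∀ o ∈ Finset.univ, z o ∈ s := by
    rintro (_ | i) -
    exacts [h₀, hx i]
  have hw : ∀ o ∈ Finset.univ, 0 ≤ w o := by
    rintro (_ | i) -
    · have := mul_le_mul_of_nonneg_left (abs_le.1 hcs).2 hη0.le
      simp only [w, Option.elim]; linarith
    · have := mul_le_mul_of_nonneg_left (abs_le.1 (hc i)).1 hη0.le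
      simp only [w, Option.elim]; linarith
  have hw1 : ∑ o, w o = 1 := by
    rw [Fintype.sum_option]
    simp only [w, Option.elim]
    rw [Finset.sum_add_distrib, ← Finset.mul_sum, Finset.sum_const, Finset.card_univ,
      nsmul_eq_mul]
    have : N⁻¹ * N = 1 := inv_mul_cancel₀ hN0.ne'
    rw [hN] at this ⊢
    linarith
  have := hs.sum_mem hw hw1 hz
  convert this using 1
  rw [Fintype.sum_option]
  simp only [w, z, Option.elim, add_smul, sub_smul, smul_add, Finset.sum_add_distrib,
    Finset.smul_sum, smul_sub, Finset.sum_sub_distrib, mul_smul, Finset.sum_smul, Finset.mul_sum]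
  abel

theorem card_le_of_pseudoShatters {α : Type*} {𝓕 : Set (α → ℝ)} {C : ℕ}
    (hC : pseudoDimension 𝓕 = (C : ℕ∞)) {s : Finset α} (hs : PseudoShatters 𝓕 s) :
    s.card ≤ C := by
  have h := le_iSup (fun s : {s : Finset α // PseudoShatters 𝓕 s} => ((s : Finset α).card : ℕ∞))
    ⟨s, hs⟩
  change _ ≤ pseudoDimension 𝓕 at h
  rw [hC] at h
  exact_mod_cast h

/-- With the barycentre of the functions as threshold, any sign pattern on interpolation points of
the span is realized by moving the barycentre slightly in a direction taking the values ±1 there.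
These points are thus pseudo-shattered. -/
theorem card_le_pseudoDimension_of_linearIndependent {α ι : Type*} [Fintype ι]
    {𝓕 : Set (α → ℝ)} (hconv : Convex ℝ 𝓕) {C : ℕ} (hC : pseudoDimension 𝓕 = (C : ℕ∞))
    {f₀ : α → ℝ} (h₀ : f₀ ∈ 𝓕) {f : ι → α → ℝ} (hf : ∀ i, f i ∈ 𝓕)
    (hli : LinearIndependent ℝ fun i => f i - f₀) : Fintype.card ι ≤ C := by
  classical
  have := FiniteDimensional.span_of_finite ℝ (Set.finite_range fun i => f i - f₀)
  obtain ⟨s, hcard, hs⟩ :=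
    exists_interpolation_points (Submodule.span ℝ (Set.range fun i => f i - f₀))
  rw [← finrank_span_eq_card hli, ← hcard]
  refine card_le_of_pseudoShatters hC
    ⟨(Fintype.card ι + 1 : ℝ)⁻¹ • (f₀ + ∑ i, f i), fun t _ => ?_⟩
  obtain ⟨u, hu, huz⟩ := hs fun z => if z ∈ t then 1 else -1
  obtain ⟨η, hη, hmem⟩ := exists_pos_barycentre_add_smul_mem hconv h₀ hf hu
  refine ⟨_, hmem, fun z hz => ?_⟩
  rw [Pi.add_apply, le_add_iff_nonneg_right, Pi.smul_apply, smul_eq_mul, huz z hz]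
  split_ifs with h
  · simp [h, hη.le]
  · simp [h, hη]

/-- A convex class of finite pseudo-dimension `C` spans an affine space of dimension at
most `C`. -/
theorem finiteDimensional_span_sub_of_convex {α : Type*} {𝓕 : Set (α → ℝ)}
    (hconv : Convex ℝ 𝓕) {C : ℕ} (hC : pseudoDimension 𝓕 = (C : ℕ∞)) {f₀ : α → ℝ} (h₀ : f₀ ∈ 𝓕) :
    FiniteDimensional ℝ (Submodule.span ℝ ((fun f => f - f₀) '' 𝓕)) ∧
      Module.finrank ℝ (Submodule.span ℝ ((fun f => f - f₀) '' 𝓕)) ≤ C := by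
  classical
  obtain ⟨b, hbS, hspan, hli⟩ := exists_linearIndependent ℝ ((fun f => f - f₀) '' 𝓕)
  have key : ∀ t : Finset (α → ℝ), ↑t ⊆ b → t.card ≤ C := by
    intro t ht
    have hmem : ∀ i : t, ∃ f ∈ 𝓕, f - f₀ = i := fun i => hbS (ht i.2)
    choose f hf hfe using hmem
    have h1 : LinearIndependent ℝ fun i : t => f i - f₀ := by
      simp only [hfe]
      exact hli.comp (fun i : t => (⟨i, ht i.2⟩ : b)) fun i j hij =>
        Subtype.ext (congrArg (fun x : b => (x : α → ℝ)) hij)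
    simpa using card_le_pseudoDimension_of_linearIndependent hconv hC h₀ hf h1
  have hfin : b.Finite := by
    by_contra hinf
    obtain ⟨t, ht, hcard⟩ := Set.Infinite.exists_subset_card_eq hinf (C + 1)
    have := key t ht
    omega
  rw [← hspan]
  refine ⟨FiniteDimensional.span_of_finite ℝ hfin, ?_⟩
  have := hfin.fintype
  refine (finrank_span_le_card b).trans ?_
  exact key _ (by simp)

/-! ### Deviations of empirical means and a Bernstein bound -/

/-- The empirical mean of `g` over the sample `x` minus its expectation. -/
noncomputable def empiricalDeviation {α : Type*} [MeasurableSpace α] (μ : Measure α) {n : ℕ} (x : Fin n → α)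
    (g : α → ℝ) : ℝ :=
  (∑ i, g (x i)) / n - ∫ z, g z ∂μ

theorem integrable_of_abs_le {α : Type*} [MeasurableSpace α] {μ : Measure α} [IsFiniteMeasure μ]
    {g : α → ℝ} (hg : AEMeasurable g μ) {b : ℝ} (hb : ∀ x, |g x| ≤ b) : Integrable g μ :=
  Integrable.of_bound hg.aestronglyMeasurable b (Filter.Eventually.of_forall hb)

/-- A Bernstein type tail bound for bounded i.i.d. random variables. -/
theorem measure_le_empiricalDeviation_le {α : Type*} [MeasurableSpace α] (μ : Measure α)
    [IsProbabilityMeasure μ] {g : α → ℝ} (hg : AEMeasurable g μ) {b : ℝ} (hb : ∀ x, |g x| ≤ b)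
    {s : ℝ} (hs : ∫ z, g z ^ 2 ∂μ ≤ s) {lam : ℝ} (hlam : 0 ≤ lam) (hlamb : lam * (2 * b) ≤ 1)
    {n : ℕ} (hn : 0 < n) (t : ℝ) :
    (Measure.pi fun _ : Fin n => μ) {x | t ≤ empiricalDeviation μ x g} ≤
      ENNReal.ofReal (Real.exp (-(n * (lam * t - lam ^ 2 * s)))) := by
  set m : ℝ := ∫ z, g z ∂μ with hm
  have hgi : Integrable g μ := integrable_of_abs_le hg hb
  have hg2i : Integrable (fun z => g z ^ 2) μ :=
    integrable_of_abs_le (b := b ^ 2) (hg.pow_const 2) fun x => by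
      rw [abs_pow]; exact pow_le_pow_left₀ (abs_nonneg _) (hb x) 2
  have hmb : |m| ≤ b := by
    have := norm_integral_le_of_norm_le_const (μ := μ) (f := g) (C := b) (Filter.Eventually.of_forall hb)
    simpa using this
  set Y : α → ℝ := fun z => lam * (g z - m) with hY
  have hYm : AEMeasurable Y μ := (hg.sub_const m).const_mul lam
  have hY1 : ∀ z, |Y z| ≤ 1 := fun z => by
    rw [hY, abs_mul, abs_of_nonneg hlam]
    refine le_trans (mul_le_mul_of_nonneg_left ?_ hlam) hlamb
    have := abs_sub (g z) m
    linarith [hb z]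
  have hexpi : Integrable (fun z => Real.exp (Y z)) μ :=
    integrable_of_abs_le (b := Real.exp 1) hYm.exp fun x => by
      rw [Real.abs_exp]; exact Real.exp_le_exp.2 (abs_le.1 (hY1 x)).2
  have hYi : Integrable Y μ := integrable_of_abs_le hYm hY1
  have hY2 : (fun z => Y z ^ 2) = fun z => lam ^ 2 * (g z ^ 2 - 2 * m * g z + m ^ 2) := by
    funext z; simp only [hY]; ring
  have hY2i : Integrable (fun z => Y z ^ 2) μ := by
    rw [hY2]
    exact ((hg2i.sub (hgi.const_mul _)).add (integrable_const _)).const_mul _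
  have hIY : ∫ z, Y z ∂μ = 0 := by
    simp only [hY]
    rw [integral_const_mul, integral_sub hgi (integrable_const _)]
    simp [hm]
  have hIY2 : ∫ z, Y z ^ 2 ∂μ ≤ lam ^ 2 * s := by
    rw [hY2, integral_const_mul,
      integral_add (f := fun z => g z ^ 2 - 2 * m * g z) (hg2i.sub (hgi.const_mul _))
        (integrable_const _), integral_sub hg2i (hgi.const_mul _), integral_const_mul, ← hm]
    refine mul_le_mul_of_nonneg_left ?_ (sq_nonneg _)
    simp only [integral_const, probReal_univ, one_smul]
    nlinarith [sq_nonneg m]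
  -- For `|Y| ≤ 1`, `exp Y ≤ 1 + Y + Y²`; the mean of `Y` is zero and its variance is at most `lam ^
  -- 2 * s`.
  have hmgf : ∫ z, Real.exp (Y z) ∂μ ≤ Real.exp (lam ^ 2 * s) := by
    have h1 : ∫ z, Real.exp (Y z) ∂μ ≤ ∫ z, (1 + Y z + Y z ^ 2) ∂μ := by
      refine integral_mono hexpi (((integrable_const _).add hYi).add hY2i) fun z => ?_
      have := (abs_le.1 (Real.abs_exp_sub_one_sub_id_le (hY1 z))).2
      simp only
      linarith
    rw [integral_add (f := fun z => 1 + Y z) ((integrable_const _).add hYi) hY2i,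
      integral_add (integrable_const _) hYi, hIY] at h1
    simp only [integral_const, probReal_univ, one_smul] at h1
    linarith [Real.add_one_le_exp (lam ^ 2 * s)]
  have hprod : ∫ x, ∏ i, Real.exp (Y (x i)) ∂(Measure.pi fun _ : Fin n => μ) ≤
      Real.exp (n * (lam ^ 2 * s)) := by
    rw [integral_fintype_prod_eq_prod (fun _ : Fin n => fun z => Real.exp (Y z))]
    simp only [Finset.prod_const, Finset.card_univ, Fintype.card_fin]
    rw [Real.exp_nat_mul]
    exact pow_le_pow_left₀ (integral_nonneg fun z => (Real.exp_pos _).le) hmgf n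
  have hint : Integrable (fun x : Fin n → α => ∏ i, Real.exp (Y (x i)))
      (Measure.pi fun _ : Fin n => μ) := Integrable.fintype_prod fun _ => hexpi
  have hmarkov := mul_meas_ge_le_integral_of_nonneg
    (Filter.Eventually.of_forall fun x => Finset.prod_nonneg fun i _ => (Real.exp_pos _).le) hint
    (Real.exp (n * (lam * t)))
  have hsub : {x : Fin n → α | t ≤ empiricalDeviation μ x g} ⊆
      {x | Real.exp (n * (lam * t)) ≤ ∏ i, Real.exp (Y (x i))} := by
    intro x hx
    simp only [Set.mem_ofPred_eq, empiricalDeviation, ← hm] at hx ⊢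
    rw [← Real.exp_sum]
    refine Real.exp_le_exp.2 ?_
    have hn' : (0 : ℝ) < n := by exact_mod_cast hn
    have h1 : ∑ i, Y (x i) = n * (lam * ((∑ i, g (x i)) / n - m)) := by
      simp only [hY]
      rw [← Finset.mul_sum, Finset.sum_sub_distrib]
      simp only [Finset.sum_const, Finset.card_univ, Fintype.card_fin, nsmul_eq_mul]
      field_simp
    rw [h1]
    exact mul_le_mul_of_nonneg_left (mul_le_mul_of_nonneg_left hx hlam) hn'.le
  refine (measure_mono hsub).trans ?_
  rw [← ofReal_measureReal]
  refine ENNReal.ofReal_le_ofReal ?_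
  have h2 := hmarkov.trans hprod
  rw [mul_comm, ← le_div_iff₀ (Real.exp_pos _), ← Real.exp_sub] at h2
  refine h2.trans (Real.exp_le_exp.2 ?_)
  linarith

/-- Two-sided form of `measure_le_empiricalDeviation_le`. -/
theorem measure_le_abs_empiricalDeviation_le {α : Type*} [MeasurableSpace α] (μ : Measure α)
    [IsProbabilityMeasure μ] {g : α → ℝ} (hg : AEMeasurable g μ) {b : ℝ} (hb : ∀ x, |g x| ≤ b)
    {s : ℝ} (hs : ∫ z, g z ^ 2 ∂μ ≤ s) {lam : ℝ} (hlam : 0 ≤ lam) (hlamb : lam * (2 * b) ≤ 1)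
    {n : ℕ} (hn : 0 < n) (t : ℝ) :
    (Measure.pi fun _ : Fin n => μ) {x | t ≤ |empiricalDeviation μ x g|} ≤
      ENNReal.ofReal (2 * Real.exp (-(n * (lam * t - lam ^ 2 * s)))) := by
  have h1 := measure_le_empiricalDeviation_le μ hg hb hs hlam hlamb hn t
  have h2 := measure_le_empiricalDeviation_le μ (g := fun z => -g z) hg.neg
    (fun x => by rw [abs_neg]; exact hb x) (by simpa using hs) hlam hlamb hn t
  have hsub : {x : Fin n → α | t ≤ |empiricalDeviation μ x g|} ⊆
      {x | t ≤ empiricalDeviation μ x g} ∪ {x | t ≤ empiricalDeviation μ x fun z => -g z} := by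
    intro x hx
    have : empiricalDeviation μ x (fun z => -g z) = -empiricalDeviation μ x g := by
      simp only [empiricalDeviation, Finset.sum_neg_distrib, integral_neg]; ring
    simp only [Set.mem_union, Set.mem_ofPred_eq, this] at hx ⊢
    exact le_abs.1 hx
  refine (measure_mono hsub).trans ((measure_union_le _ _).trans ((add_le_add h1 h2).trans ?_))
  rw [← ENNReal.ofReal_add (Real.exp_pos _).le (Real.exp_pos _).le, two_mul]

theorem empiricalDeviation_add {α : Type*} [MeasurableSpace α] {μ : Measure α} {n : ℕ}
    (x : Fin n → α) {g h : α → ℝ} (hg : Integrable g μ) (hh : Integrable h μ) :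
    empiricalDeviation μ x (fun z => g z + h z) =
      empiricalDeviation μ x g + empiricalDeviation μ x h := by
  simp only [empiricalDeviation, Finset.sum_add_distrib, integral_add hg hh]
  ring

theorem empiricalDeviation_const_mul {α : Type*} [MeasurableSpace α] {μ : Measure α} {n : ℕ}
    (x : Fin n → α) (r : ℝ) (g : α → ℝ) :
    empiricalDeviation μ x (fun z => r * g z) = r * empiricalDeviation μ x g := by
  simp only [empiricalDeviation, ← Finset.mul_sum, integral_const_mul]
  ring

theorem abs_empiricalDeviation_le {α : Type*} [MeasurableSpace α] {μ : Measure α}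
    [IsProbabilityMeasure μ] {n : ℕ} (hn : 0 < n) (x : Fin n → α) {g : α → ℝ} {b : ℝ}
    (hb : ∀ x, |g x| ≤ b) : |empiricalDeviation μ x g| ≤ 2 * b := by
  have hn' : (0 : ℝ) < n := by exact_mod_cast hn
  have h1 : |∫ z, g z ∂μ| ≤ b := by
    have := norm_integral_le_of_norm_le_const (μ := μ) (f := g) (C := b) (Filter.Eventually.of_forall hb)
    simpa using this
  have h2 : |(∑ i, g (x i)) / n| ≤ b := by
    rw [abs_div, abs_of_pos hn', div_le_iff₀ hn']
    refine (Finset.abs_sum_le_sum_abs _ _).trans ((Finset.sum_le_card_nsmul _ _ b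
      fun i _ => hb _).trans (le_of_eq ?_))
    simp [mul_comm]
  have h3 := abs_sub ((∑ i, g (x i)) / n) (∫ z, g z ∂μ)
  simp only [empiricalDeviation]
  linarith

/-! ### Localized uniform deviations for finite-dimensional families -/

theorem memLp_of_abs_le {α : Type*} [MeasurableSpace α] {μ : Measure α} [IsFiniteMeasure μ]
    {g : α → ℝ} (hg : AEMeasurable g μ) {b : ℝ} (hb : ∀ x, |g x| ≤ b) (p : ENNReal) :
    MemLp g p μ :=
  MemLp.of_bound hg.aestronglyMeasurable b (Filter.Eventually.of_forall hb)

theorem sq_lpNorm_two {α : Type*} [MeasurableSpace α] {μ : Measure α} {g : α → ℝ}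
    (hg : AEMeasurable g μ) : lpNorm g 2 μ ^ 2 = ∫ z, g z ^ 2 ∂μ := by
  rw [lpNorm_eq_integral_norm_rpow_toReal two_ne_zero ENNReal.ofNat_ne_top
    hg.aestronglyMeasurable]
  have h0 : 0 ≤ ∫ z, ‖g z‖ ^ (2 : ENNReal).toReal ∂μ :=
    integral_nonneg fun z => Real.rpow_nonneg (norm_nonneg _) _
  rw [← Real.rpow_natCast, ← Real.rpow_mul h0]
  norm_num

/-- A family of bounded measurable functions depending linearly on a parameter. -/
structure IsBoundedFamily {α E : Type*} [MeasurableSpace α] [AddCommGroup E] [Module ℝ E]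
    (μ : Measure α) (Φ : E →ₗ[ℝ] α → ℝ) : Prop where
  aemeasurable : ∀ c, AEMeasurable (Φ c) μ
  bounded : ∀ c, ∃ b, ∀ x, |Φ c x| ≤ b

namespace IsBoundedFamily

variable {α E : Type*} [MeasurableSpace α] [AddCommGroup E] [Module ℝ E] {μ : Measure α}
  {Φ : E →ₗ[ℝ] α → ℝ}

theorem bddAbove (h : IsBoundedFamily μ Φ) (c : E) : BddAbove (Set.range fun x => |Φ c x|) := by
  obtain ⟨b, hb⟩ := h.bounded c
  exact ⟨b, by rintro _ ⟨x, rfl⟩; exact hb x⟩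

/-- The seminorm `‖Φ c‖₂ + ρ * ‖Φ c‖_∞` of the parameters of a bounded family. -/
noncomputable def seminorm [IsFiniteMeasure μ] [Nonempty α] (h : IsBoundedFamily μ Φ) {ρ : ℝ}
    (hρ : 0 ≤ ρ) : Seminorm ℝ E :=
  Seminorm.of (fun c => lpNorm (Φ c) 2 μ + ρ * ⨆ x, |Φ c x|)
    (fun u v => by
      obtain ⟨b, hb⟩ := h.bounded u
      have h1 : lpNorm (Φ (u + v)) 2 μ ≤ lpNorm (Φ u) 2 μ + lpNorm (Φ v) 2 μ := by
        rw [map_add]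
        exact lpNorm_add_le (memLp_of_abs_le (h.aemeasurable u) hb 2) one_le_two
      have h2 : ⨆ x, |Φ (u + v) x| ≤ (⨆ x, |Φ u x|) + ⨆ x, |Φ v x| := by
        refine ciSup_le fun x => ?_
        rw [map_add, Pi.add_apply]
        exact (abs_add_le _ _).trans (add_le_add (le_ciSup (h.bddAbove u) x)
          (le_ciSup (h.bddAbove v) x))
      have := mul_le_mul_of_nonneg_left h2 hρ
      linarith)
    (fun a u => by
      have h2 : ⨆ x, |Φ (a • u) x| = |a| * ⨆ x, |Φ u x| := by
        rw [Real.mul_iSup_of_nonneg (abs_nonneg a)]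
        simp only [map_smul, Pi.smul_apply, smul_eq_mul, abs_mul]
      rw [h2, map_smul, lpNorm_const_smul]
      simp only [coe_nnnorm, Real.norm_eq_abs]
      ring)

theorem seminorm_apply [IsFiniteMeasure μ] [Nonempty α] (h : IsBoundedFamily μ Φ) {ρ : ℝ}
    (hρ : 0 ≤ ρ) (c : E) :
    h.seminorm hρ c = lpNorm (Φ c) 2 μ + ρ * ⨆ x, |Φ c x| := rfl

theorem mul_abs_le_seminorm [IsFiniteMeasure μ] [Nonempty α] (h : IsBoundedFamily μ Φ) {ρ : ℝ}
    (hρ : 0 ≤ ρ) (c : E) (x : α) : ρ * |Φ c x| ≤ h.seminorm hρ c := by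
  rw [seminorm_apply]
  have := mul_le_mul_of_nonneg_left (le_ciSup (h.bddAbove c) x) hρ
  have := lpNorm_nonneg (f := Φ c) (p := 2) (μ := μ)
  linarith

theorem lpNorm_le_seminorm [IsFiniteMeasure μ] [Nonempty α] (h : IsBoundedFamily μ Φ) {ρ : ℝ}
    (hρ : 0 ≤ ρ) (c : E) : lpNorm (Φ c) 2 μ ≤ h.seminorm hρ c := by
  rw [seminorm_apply]
  have : 0 ≤ ⨆ x, |Φ c x| := Real.iSup_nonneg fun x => abs_nonneg _
  nlinarith

theorem seminorm_le_of_abs_le_one [IsFiniteMeasure μ] [Nonempty α] (h : IsBoundedFamily μ Φ)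
    {ρ : ℝ} (hρ : 0 ≤ ρ) {c : E} (hc : ∀ x, |Φ c x| ≤ 1) :
    h.seminorm hρ c ≤ lpNorm (Φ c) 2 μ + ρ := by
  rw [seminorm_apply]
  have := mul_le_mul_of_nonneg_left (ciSup_le hc) hρ
  linarith

theorem integrable_mul (h : IsBoundedFamily μ Φ) [IsFiniteMeasure μ] {a : α → ℝ}
    (ha : AEMeasurable a μ) {A : ℝ} (hA : ∀ x, |a x| ≤ A) (c : E) :
    Integrable (fun z => a z * Φ c z) μ := by
  obtain ⟨b, hb⟩ := h.bounded c
  refine integrable_of_abs_le (b := A * b) (ha.mul (h.aemeasurable c)) fun x => ?_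
  rw [abs_mul]
  exact mul_le_mul (hA x) (hb x) (abs_nonneg _) ((abs_nonneg _).trans (hA x))

theorem integrable_mul_self (h : IsBoundedFamily μ Φ) [IsFiniteMeasure μ] (c c' : E) :
    Integrable (fun z => Φ c z * Φ c' z) μ := by
  obtain ⟨b, hb⟩ := h.bounded c
  exact h.integrable_mul (h.aemeasurable c) hb c'

/-- The deviation of the weighted empirical mean as a linear form. -/
noncomputable def linearDeviation [IsFiniteMeasure μ] (h : IsBoundedFamily μ Φ) {a : α → ℝ}
    (ha : AEMeasurable a μ) {A : ℝ} (hA : ∀ x, |a x| ≤ A) {n : ℕ} (x : Fin n → α) : E →ₗ[ℝ] ℝ where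
  toFun c := empiricalDeviation μ x fun z => a z * Φ c z
  map_add' u v := by
    rw [← empiricalDeviation_add x (h.integrable_mul ha hA u) (h.integrable_mul ha hA v)]
    simp only [map_add, Pi.add_apply, mul_add]
  map_smul' r u := by
    rw [RingHom.id_apply, smul_eq_mul, ← empiricalDeviation_const_mul]
    simp only [map_smul, Pi.smul_apply, smul_eq_mul]
    congr 1; funext z; ring

/-- The deviation of the empirical second moments as a bilinear form. -/
noncomputable def bilinearDeviation [IsFiniteMeasure μ] (h : IsBoundedFamily μ Φ) {n : ℕ}
    (x : Fin n → α) : E →ₗ[ℝ] E →ₗ[ℝ] ℝ :=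
  LinearMap.mk₂ ℝ (fun u v => empiricalDeviation μ x fun z => Φ u z * Φ v z)
    (fun u u' v => by
      rw [← empiricalDeviation_add x (h.integrable_mul_self u v) (h.integrable_mul_self u' v)]
      simp only [map_add, Pi.add_apply, add_mul])
    (fun r u v => by
      rw [smul_eq_mul, ← empiricalDeviation_const_mul]
      simp only [map_smul, Pi.smul_apply, smul_eq_mul, mul_assoc])
    (fun u v v' => by
      rw [← empiricalDeviation_add x (h.integrable_mul_self u v) (h.integrable_mul_self u v')]
      simp only [map_add, Pi.add_apply, mul_add])
    (fun r u v => by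
      rw [smul_eq_mul, ← empiricalDeviation_const_mul]
      simp only [map_smul, Pi.smul_apply, smul_eq_mul]
      congr 1; funext z; ring)

/-- Uniform localized deviation bounds for the weighted means and the second moments of a
finite-dimensional bounded family. -/
theorem exists_uniform_deviation [FiniteDimensional ℝ E] [IsProbabilityMeasure μ] [Nonempty α]
    (h : IsBoundedFamily μ Φ) {a : α → ℝ} (ha : AEMeasurable a μ) {A : ℝ} (hA0 : 0 < A)
    (hA : ∀ x, |a x| ≤ A) {ρ : ℝ} (hρ : 0 < ρ) {n : ℕ} (hn : 0 < n) :
    ∃ bad : Set (Fin n → α), (Measure.pi fun _ : Fin n => μ) bad ≤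
        ENNReal.ofReal (4 * 17 ^ Module.finrank ℝ E * Real.exp (-(n * ρ ^ 2 / 256))) ∧
      ∀ x ∉ bad, ∀ c,
        |empiricalDeviation μ x fun z => a z * Φ c z| ≤ 2 * (A * ρ) * h.seminorm hρ.le c ∧
        |empiricalDeviation μ x fun z => Φ c z * Φ c z| ≤ 1 / 4 * h.seminorm hρ.le c ^ 2 := by
  classical
  set N := h.seminorm hρ.le with hN
  obtain ⟨T, hTcard, hT1, hT⟩ := exists_eighth_net N
  set e : ℝ := Real.exp (-(n * ρ ^ 2 / 256)) with he
  have hn' : (0 : ℝ) < n := by exact_mod_cast hn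
  let badL : E → Set (Fin n → α) := fun c =>
    {x | A * ρ ≤ |empiricalDeviation μ x fun z => a z * Φ c z|}
  let badQ : E → Set (Fin n → α) := fun c =>
    {x | 1 / 8 ≤ |empiricalDeviation μ x fun z => Φ c z * Φ c z|}
  -- The mixed seminorm gives on its unit ball exactly what Bernstein needs: sup norm at most `1/ρ`
  -- and second moment at most one.
  have hsup : ∀ c, N c ≤ 1 → ∀ x, |Φ c x| ≤ 1 / ρ := fun c hc x => by
    rw [le_div_iff₀ hρ, mul_comm]
    exact (h.mul_abs_le_seminorm hρ.le c x).trans hc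
  have hl2 : ∀ c, N c ≤ 1 → ∫ z, Φ c z ^ 2 ∂μ ≤ 1 := fun c hc => by
    rw [← sq_lpNorm_two (h.aemeasurable c)]
    exact pow_le_one₀ lpNorm_nonneg ((h.lpNorm_le_seminorm hρ.le c).trans hc)
  have hsqi : ∀ c, Integrable (fun z => Φ c z ^ 2) μ := fun c => by
    simpa only [sq] using h.integrable_mul_self c c
  have hL : ∀ c ∈ T, (Measure.pi fun _ : Fin n => μ) (badL c) ≤ ENNReal.ofReal (2 * e) := by
    intro c hc
    have hc1 := hT1 c hc
    have hb : ∀ x, |a x * Φ c x| ≤ A * (1 / ρ) := fun x => by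
      rw [abs_mul]
      exact mul_le_mul (hA x) (hsup c hc1 x) (abs_nonneg _) hA0.le
    have hs : ∫ z, (a z * Φ c z) ^ 2 ∂μ ≤ A ^ 2 := by
      have h1 : ∫ z, (a z * Φ c z) ^ 2 ∂μ ≤ ∫ z, A ^ 2 * Φ c z ^ 2 ∂μ := by
        refine integral_mono (integrable_of_abs_le (b := (A * (1 / ρ)) ^ 2)
          ((ha.mul (h.aemeasurable c)).pow_const 2) fun x => ?_) ((hsqi c).const_mul _) fun z => ?_
        · rw [abs_pow]
          exact pow_le_pow_left₀ (abs_nonneg _) (hb x) 2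
        · simp only
          rw [mul_pow]
          refine mul_le_mul_of_nonneg_right ?_ (sq_nonneg _)
          rw [← sq_abs (a z)]
          exact pow_le_pow_left₀ (abs_nonneg _) (hA z) 2
      rw [integral_const_mul] at h1
      nlinarith [hl2 c hc1, sq_nonneg A]
    -- This `lam` is the optimal `t / (2s)` for `t = A * ρ`, `s = A ^ 2`; it just meets the
    -- constraint `lam * 2b ≤ 1`.
    refine (measure_le_abs_empiricalDeviation_le μ (ha.mul (h.aemeasurable c)) hb hs
      (lam := ρ / (2 * A)) (by positivity) (le_of_eq (by field_simp)) hn (A * ρ)).trans ?_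
    refine ENNReal.ofReal_le_ofReal (mul_le_mul_of_nonneg_left (Real.exp_le_exp.2 ?_) two_pos.le)
    have : ρ / (2 * A) * (A * ρ) - (ρ / (2 * A)) ^ 2 * A ^ 2 = ρ ^ 2 / 4 := by
      field_simp; ring
    rw [this]
    have : 0 < n * ρ ^ 2 := by positivity
    linarith
  have hQ : ∀ c ∈ T, (Measure.pi fun _ : Fin n => μ) (badQ c) ≤ ENNReal.ofReal (2 * e) := by
    intro c hc
    have hc1 := hT1 c hc
    have hb : ∀ x, |Φ c x * Φ c x| ≤ 1 / ρ * (1 / ρ) := fun x => by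
      rw [abs_mul]
      exact mul_le_mul (hsup c hc1 x) (hsup c hc1 x) (abs_nonneg _) (by positivity)
    have hs : ∫ z, (Φ c z * Φ c z) ^ 2 ∂μ ≤ 1 / ρ * (1 / ρ) := by
      have h1 : ∫ z, (Φ c z * Φ c z) ^ 2 ∂μ ≤ ∫ z, 1 / ρ * (1 / ρ) * Φ c z ^ 2 ∂μ := by
        refine integral_mono (integrable_of_abs_le (b := (1 / ρ * (1 / ρ)) ^ 2)
          (((h.aemeasurable c).mul (h.aemeasurable c)).pow_const 2) fun x => ?_)
          ((hsqi c).const_mul _) fun z => ?_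
        · rw [abs_pow]
          exact pow_le_pow_left₀ (abs_nonneg _) (hb x) 2
        · have := mul_le_mul_of_nonneg_right (hb z) (sq_nonneg (Φ c z))
          rw [abs_mul_self] at this
          simp only
          nlinarith
      rw [integral_const_mul] at h1
      have : 0 < 1 / ρ * (1 / ρ) := by positivity
      nlinarith [hl2 c hc1]
    -- Again `lam = t / (2s)`, now with `t = 1/8` and `s = 1/ρ²`; this gives the exponent `ρ²/256`.
    refine (measure_le_abs_empiricalDeviation_le μ ((h.aemeasurable c).mul (h.aemeasurable c)) hb
      hs (lam := ρ ^ 2 / 16) (by positivity) ?_ hn (1 / 8)).trans ?_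
    · have : ρ ^ 2 / 16 * (2 * (1 / ρ * (1 / ρ))) = 1 / 8 := by field_simp; norm_num
      rw [this]; norm_num
    refine ENNReal.ofReal_le_ofReal (mul_le_mul_of_nonneg_left (Real.exp_le_exp.2 ?_) two_pos.le)
    have : ρ ^ 2 / 16 * (1 / 8) - (ρ ^ 2 / 16) ^ 2 * (1 / ρ * (1 / ρ)) = ρ ^ 2 / 256 := by
      field_simp; norm_num
    rw [this, mul_div_assoc]
  refine ⟨⋃ c ∈ T, (badL c ∪ badQ c), ?_, ?_⟩
  · refine (measure_biUnion_finset_le T _).trans ?_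
    have h1 : ∀ c ∈ T, (Measure.pi fun _ : Fin n => μ) (badL c ∪ badQ c) ≤
        ENNReal.ofReal (4 * e) := fun c hc => by
      refine (measure_union_le _ _).trans ((add_le_add (hL c hc) (hQ c hc)).trans ?_)
      rw [← ENNReal.ofReal_add (by positivity) (by positivity)]
      exact ENNReal.ofReal_le_ofReal (by linarith)
    refine (Finset.sum_le_card_nsmul T _ _ h1).trans ?_
    rw [nsmul_eq_mul, ← ENNReal.ofReal_natCast, ← ENNReal.ofReal_mul (by positivity)]
    refine ENNReal.ofReal_le_ofReal ?_
    have h2 : (T.card : ℝ) ≤ 17 ^ Module.finrank ℝ E := by exact_mod_cast hTcard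
    have h3 : 0 < e := Real.exp_pos _
    nlinarith
  · intro x hx c
    simp only [Set.mem_iUnion, Set.mem_union, not_exists, not_or] at hx
    have hle : ∀ c y, |Φ c y| ≤ N c / ρ := fun c y => by
      rw [le_div_iff₀ hρ, mul_comm]; exact h.mul_abs_le_seminorm hρ.le c y
    constructor
    · refine abs_linear_le_of_net N hT (h.linearDeviation ha hA x) (B := 2 * (A / ρ)) ?_ ?_ c
      · intro v
        rw [show 2 * (A / ρ) * N v = 2 * (A * (N v / ρ)) by ring]
        refine abs_empiricalDeviation_le (μ := μ) hn x (g := fun y => a y * Φ v y) fun y => ?_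
        rw [abs_mul]
        exact mul_le_mul (hA y) (hle v y) (abs_nonneg _) hA0.le
      · exact fun w hw => (not_le.1 (hx w hw).1).le
    · have := abs_quadratic_le_of_net N hT1 hT (h.bilinearDeviation x) (B := 2 / ρ ^ 2) (M := 1 / 8)
        ?_ ?_ ?_ c
      · refine this.trans (le_of_eq (by ring))
      · intro u v
        simp only [bilinearDeviation, LinearMap.mk₂_apply, mul_comm]
      · intro v
        rw [show 2 / ρ ^ 2 * N v ^ 2 = 2 * (N v / ρ * (N v / ρ)) by field_simp]
        refine abs_empiricalDeviation_le (μ := μ) hn x (g := fun y => Φ v y * Φ v y) fun y => ?_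
        rw [abs_mul]
        exact mul_le_mul (hle v y) (hle v y) (abs_nonneg _) ((abs_nonneg _).trans (hle v y))
      · exact fun w hw => (not_le.1 (hx w hw).2).le

/-- A consequence of the localized deviation bounds for elements whose empirical second moment is
dominated by the deviation of a weighted mean. -/
theorem exists_lpNorm_le [FiniteDimensional ℝ E] [IsProbabilityMeasure μ] [Nonempty α]
    (h : IsBoundedFamily μ Φ) {a : α → ℝ} (ha : AEMeasurable a μ) {A : ℝ} (hA0 : 0 < A)
    (hA : ∀ x, |a x| ≤ A) {ρ : ℝ} (hρ : 0 < ρ) {n : ℕ} (hn : 0 < n) :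
    ∃ bad : Set (Fin n → α), (Measure.pi fun _ : Fin n => μ) bad ≤
        ENNReal.ofReal (4 * 17 ^ Module.finrank ℝ E * Real.exp (-(n * ρ ^ 2 / 256))) ∧
      ∀ x ∉ bad, ∀ c, (∀ z, |Φ c z| ≤ 1) → ∀ κ : ℝ, 0 < κ →
        κ * ((∑ i, Φ c (x i) * Φ c (x i)) / n) ≤ empiricalDeviation μ x (fun z => a z * Φ c z) →
        lpNorm (Φ c) 2 μ ≤ (1 + 8 * A / κ) * ρ := by
  obtain ⟨bad, hbad, hgood⟩ := h.exists_uniform_deviation ha hA0 hA hρ hn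
  refine ⟨bad, hbad, fun x hx c hc κ hκ hle => ?_⟩
  obtain ⟨h1, h2⟩ := hgood x hx c
  have h3 := h.seminorm_le_of_abs_le_one hρ.le hc
  have h5 : ∫ z, Φ c z * Φ c z ∂μ = lpNorm (Φ c) 2 μ ^ 2 := by
    rw [sq_lpNorm_two (h.aemeasurable c)]; simp only [sq]
  have h4 := (abs_le.1 h2).1
  rw [empiricalDeviation, h5] at h4
  have h6 := (abs_le.1 h1).2
  have h0 : 0 ≤ lpNorm (Φ c) 2 μ := lpNorm_nonneg
  have hN0 := apply_nonneg (h.seminorm hρ.le) c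
  set r := lpNorm (Φ c) 2 μ
  set N := h.seminorm hρ.le c
  set S := (∑ i, Φ c (x i) * Φ c (x i)) / (n : ℝ)
  have h7 : N ^ 2 ≤ 2 * r ^ 2 + 2 * ρ ^ 2 := by
    have := pow_le_pow_left₀ hN0 h3 2
    nlinarith [sq_nonneg (r - ρ)]
  -- The quadratic deviation costs at most `N²/4`, hence half of `r²`, so the empirical second
  -- moment still dominates. With the linear bound of order `ρ (r + ρ)` this forces `r` to be of
  -- order `ρ`.
  have h8 : r ^ 2 / 2 - ρ ^ 2 / 2 ≤ S := by linarith
  have h9 : κ * S ≤ 2 * (A * ρ) * (r + ρ) :=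
    (hle.trans h6).trans (mul_le_mul_of_nonneg_left h3 (by positivity))
  have h10 : S ≤ 2 * (A * ρ) * (r + ρ) / κ := by rw [le_div_iff₀ hκ]; linarith
  have hAk : 0 < A / κ := by positivity
  have h11 : 2 * (A * ρ) * (r + ρ) / κ = 2 * (A / κ) * ρ * (r + ρ) := by ring
  have h12 : 8 * A / κ = 8 * (A / κ) := by ring
  rw [h11] at h10
  rw [h12]
  rcases le_total r ρ with hr | hr
  · nlinarith
  · by_contra! hcon
    have h13 : 0 < r := lt_of_lt_of_le hρ hr
    have h14 : (1 + 8 * (A / κ)) * ρ * r < r * r := mul_lt_mul_of_pos_right hcon h13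
    have h15 : ρ * ρ ≤ ρ * r := mul_le_mul_of_nonneg_left hr hρ.le
    have h16 : A / κ * ρ * ρ ≤ A / κ * ρ * r := mul_le_mul_of_nonneg_left hr (by positivity)
    nlinarith

end IsBoundedFamily

/-! ### Pointwise inequalities on `[γ, 1]` -/

/-- The right side is at least `(√s - √p)²`, by `log x ≤ x - 1` at `x = √p/√s`; the factor `(√s +
√p)² ≤ 4` then passes to `(s - p)²`. -/
theorem quarter_sq_sub_le_mul_log {s p : ℝ} (hs : 0 < s) (hs1 : s ≤ 1) (hp : 0 < p)
    (hp1 : p ≤ 1) : (s - p) ^ 2 / 4 ≤ s * (Real.log s - Real.log p) - s + p := by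
  set a := Real.sqrt s with ha
  set b := Real.sqrt p with hb
  have ha0 : 0 < a := Real.sqrt_pos.2 hs
  have hb0 : 0 < b := Real.sqrt_pos.2 hp
  have ha1 : a ≤ 1 := Real.sqrt_le_one.2 hs1
  have hb1 : b ≤ 1 := Real.sqrt_le_one.2 hp1
  have hsa : s = a ^ 2 := (Real.sq_sqrt hs.le).symm
  have hpb : p = b ^ 2 := (Real.sq_sqrt hp.le).symm
  have h1 := Real.log_le_sub_one_of_pos (div_pos hb0 ha0)
  rw [Real.log_div hb0.ne' ha0.ne'] at h1
  rw [hsa, hpb, Real.log_pow, Real.log_pow]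
  have h2 : a ^ 2 * (Real.log b - Real.log a) ≤ a ^ 2 * (b / a - 1) :=
    mul_le_mul_of_nonneg_left h1 (sq_nonneg a)
  have h3 : a ^ 2 * (b / a - 1) = a * b - a ^ 2 := by field_simp
  have h4 : (a ^ 2 - b ^ 2) ^ 2 = (a + b) ^ 2 * (a - b) ^ 2 := by ring
  have h5 : (a + b) ^ 2 ≤ 4 := by nlinarith
  have h6 := mul_le_mul_of_nonneg_right h5 (sq_nonneg (a - b))
  rw [h4]
  push_cast
  nlinarith

theorem abs_log_le {γ t : ℝ} (hγ : 0 < γ) (ht : t ∈ Set.Icc γ 1) : |Real.log t| ≤ 1 / γ - 1 := by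
  have h0 : 0 < t := hγ.trans_le ht.1
  rw [abs_of_nonpos (Real.log_nonpos h0.le ht.2), ← Real.log_inv]
  refine (Real.log_le_sub_one_of_pos (inv_pos.2 h0)).trans ?_
  have := one_div_le_one_div_of_le hγ ht.1
  rw [← one_div]
  linarith

theorem abs_sub_le_one {γ s t : ℝ} (hγ : 0 < γ) (hs : s ∈ Set.Icc γ 1) (ht : t ∈ Set.Icc γ 1) :
    |s - t| ≤ 1 := by
  rw [abs_le]
  constructor <;> linarith [hs.1, hs.2, ht.1, ht.2]

theorem sub_div_le_log_sub_log {s t : ℝ} (hs : 0 < s) (ht : 0 < t) :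
    (s - t) / s ≤ Real.log s - Real.log t := by
  have := Real.log_le_sub_one_of_pos (div_pos ht hs)
  rw [Real.log_div ht.ne' hs.ne'] at this
  rw [sub_div, div_self hs.ne']
  linarith

theorem weight_div_mem {γ w q : ℝ} (hγ : 0 < γ) (hw : w ∈ Set.Icc γ 1) (hq : q ∈ Set.Icc γ 1) :
    0 < w / q ∧ w / q ≤ 1 / γ :=
  ⟨div_pos (hγ.trans_le hw.1) (hγ.trans_le hq.1), div_le_div₀ one_pos.le hw.2 hγ hq.1⟩

/-- First-order expansion along a segment with an error of order `θ²`; dividing by `θ` and letting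
it tend to zero will yield the optimality condition. -/
theorem mul_log_div_perturb_le {γ w q f θ : ℝ} (hγ : 0 < γ) (hw : w ∈ Set.Icc γ 1)
    (hq : q ∈ Set.Icc γ 1) (hf : f ∈ Set.Icc γ 1) (hθ : 0 < θ) (hθ1 : θ ≤ 1) :
    w * Real.log (w / (q + θ * (f - q))) ≤
      w * Real.log (w / q) - θ * (w * ((f - q) / q)) + θ ^ 2 * (1 / γ ^ 2) := by
  have hw0 := hγ.trans_le hw.1
  have hq0 := hγ.trans_le hq.1
  have hr : γ ≤ q + θ * (f - q) := by nlinarith [hq.1, hf.1]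
  have hr0 := hγ.trans_le hr
  set r := q + θ * (f - q) with hrdef
  rw [Real.log_div hw0.ne' hr0.ne', Real.log_div hw0.ne' hq0.ne']
  have h1 := sub_div_le_log_sub_log hr0 hq0
  have h2 : (r - q) / r = θ * ((f - q) / q) - θ ^ 2 * ((f - q) ^ 2 / (q * r)) := by
    field_simp
    rw [hrdef]; ring
  have h3 : (f - q) ^ 2 / (q * r) ≤ 1 / γ ^ 2 := by
    refine div_le_div₀ one_pos.le ?_ (by positivity) (by nlinarith [hq.1])
    have := abs_sub_le_one hγ hf hq
    rw [← sq_abs]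
    exact pow_le_one₀ (abs_nonneg _) this
  have h4 : θ * ((f - q) / q) - θ ^ 2 * (1 / γ ^ 2) ≤ Real.log r - Real.log q := by
    nlinarith [sq_nonneg θ]
  have h5 := mul_le_mul_of_nonneg_left h4 hw0.le
  have h6 : w * (θ ^ 2 * (1 / γ ^ 2)) ≤ θ ^ 2 * (1 / γ ^ 2) :=
    mul_le_of_le_one_left (by positivity) hw.2
  nlinarith

/-- An identity except for the last term, which bounds `(w/q)(p - s)`. -/
theorem pythagorean_pointwise {γ w q p s : ℝ} (hγ : 0 < γ) (hw : w ∈ Set.Icc γ 1)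
    (hq : q ∈ Set.Icc γ 1) (hp : p ∈ Set.Icc γ 1) :
    q * Real.log (q / p) + w * Real.log (w / q) ≤
      w * Real.log (w / p) + (q - w) * (p / q - Real.log (p / q) - 1) + (q - p)
        + w * ((s - q) / q) + 1 / γ * |s - p| := by
  have hw0 := hγ.trans_le hw.1
  have hq0 := hγ.trans_le hq.1
  have hp0 := hγ.trans_le hp.1
  rw [Real.log_div hw0.ne' hq0.ne', Real.log_div hq0.ne' hp0.ne', Real.log_div hw0.ne' hp0.ne',
    Real.log_div hp0.ne' hq0.ne']
  have h1 : w / q * (p - s) ≤ 1 / γ * |s - p| := by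
    obtain ⟨h2, h3⟩ := weight_div_mem hγ hw hq
    have : p - s ≤ |s - p| := by rw [abs_sub_comm]; exact le_abs_self _
    nlinarith [abs_nonneg (s - p)]
  have h2 : (q - w) * (p / q) = p - w / q * p := by field_simp
  have h3 : w * ((s - q) / q) = w / q * s - w := by field_simp
  rw [h3]
  linarith

theorem mul_log_div_lipschitz {γ f q p w : ℝ} (hγ : 0 < γ) (hf : f ∈ Set.Icc γ 1)
    (hq : q ∈ Set.Icc γ 1) (hp : p ∈ Set.Icc γ 1) (hw : w ∈ Set.Icc γ 1) :
    f * Real.log (f / p) + w * Real.log (w / f) ≤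
      q * Real.log (q / p) + w * Real.log (w / q) + 2 / γ * |f - q| := by
  have hw0 := hγ.trans_le hw.1
  have hq0 := hγ.trans_le hq.1
  have hp0 := hγ.trans_le hp.1
  have hf0 := hγ.trans_le hf.1
  rw [Real.log_div hw0.ne' hq0.ne', Real.log_div hq0.ne' hp0.ne', Real.log_div hw0.ne' hf0.ne',
    Real.log_div hf0.ne' hp0.ne']
  have h1 : (f - q) * (Real.log f - Real.log p) ≤ |f - q| * (1 / γ - 1) := by
    refine (le_abs_self _).trans ?_
    rw [abs_mul]
    refine mul_le_mul_of_nonneg_left ?_ (abs_nonneg _)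
    have h2 := abs_le.1 (abs_log_le hγ hf)
    have h3 := abs_le.1 (abs_log_le hγ hp)
    have h4 := Real.log_nonpos hf0.le hf.2
    have h5 := Real.log_nonpos hp0.le hp.2
    rw [abs_le]
    constructor <;> linarith [h2.1, h3.1]
  have h2 : q * (Real.log f - Real.log q) ≤ |f - q| := by
    have := sub_div_le_log_sub_log hq0 hf0
    rw [div_le_iff₀ hq0] at this
    linarith [le_abs_self (f - q)]
  have h3 : w * (Real.log q - Real.log f) ≤ 1 / γ * |f - q| := by
    have h4 := sub_div_le_log_sub_log hf0 hq0
    have h5 : w * (Real.log q - Real.log f) ≤ w / f * (q - f) := by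
      have := mul_le_mul_of_nonneg_left h4 hw0.le
      have h6 : w * ((f - q) / f) = - (w / f * (q - f)) := by ring
      linarith
    obtain ⟨h2, h3⟩ := weight_div_mem hγ hw hf
    have : q - f ≤ |f - q| := by rw [abs_sub_comm]; exact le_abs_self _
    nlinarith [abs_nonneg (f - q)]
  have h4 : 2 / γ * |f - q| = 1 / γ * |f - q| + 1 / γ * |f - q| := by ring
  rw [h4]
  linarith

/-- The quadratic lower bound for `q log(q/f) - q + f`, multiplied by `w/q ≥ γ`. -/
theorem mul_log_div_strongly_convex {γ w q f : ℝ} (hγ : 0 < γ) (hw : w ∈ Set.Icc γ 1)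
    (hq : q ∈ Set.Icc γ 1) (hf : f ∈ Set.Icc γ 1) :
    w * Real.log (w / q) - w / q * (f - q) + γ / 4 * ((f - q) * (f - q)) ≤
      w * Real.log (w / f) := by
  have hw0 := hγ.trans_le hw.1
  have hq0 := hγ.trans_le hq.1
  have hf0 := hγ.trans_le hf.1
  rw [Real.log_div hw0.ne' hq0.ne', Real.log_div hw0.ne' hf0.ne']
  have h1 := quarter_sq_sub_le_mul_log hq0 hq.2 hf0 hf.2
  have h2 := mul_le_mul_of_nonneg_left h1 (div_pos hw0 hq0).le
  have h3 : w / q * (q * (Real.log q - Real.log f) - q + f) =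
      w * (Real.log q - Real.log f) + w / q * (f - q) := by field_simp; ring
  have h4 : γ ≤ w / q := by
    rw [le_div_iff₀ hq0]; nlinarith [hw.1, hq.2]
  have h5 := mul_le_mul_of_nonneg_right h4 (sq_nonneg (q - f))
  nlinarith

/-! ### Integrated inequalities for densities -/

/-- A density with values in `[γ, 1]` with respect to an arbitrary measure. -/
structure IsDensity {α : Type*} [MeasurableSpace α] (ν : Measure α) (γ : ℝ) (f : α → ℝ) :
    Prop where
  aemeasurable : AEMeasurable f ν
  mem_range : ∀ᵐ x ∂ν, f x ∈ Set.Icc γ 1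
  normalized : ∫ x, f x ∂ν = 1

namespace IsDensity

variable {α : Type*} [MeasurableSpace α] {ν : Measure α} {γ : ℝ} {f g h : α → ℝ}

theorem integrable (hf : IsDensity ν γ f) : Integrable f ν := by
  -- The integral of a non-integrable function is 0 by convention, so unit mass forces
  -- integrability.
  by_contra hcon
  have := hf.normalized
  rw [integral_undef hcon] at this
  exact zero_ne_one this

theorem isFiniteMeasure (hf : IsDensity ν γ f) (hγ : 0 < γ) : IsFiniteMeasure ν := by
  have h1 : Integrable (fun _ : α => γ) ν := by
    refine hf.integrable.mono' aestronglyMeasurable_const ?_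
    filter_upwards [hf.mem_range] with x hx
    rw [Real.norm_eq_abs, abs_of_pos hγ]
    exact hx.1
  exact (integrable_const_iff_isFiniteMeasure hγ.ne').1 h1

theorem real_univ_le (hf : IsDensity ν γ f) (hγ : 0 < γ) : ν.real Set.univ ≤ 1 / γ := by
  have := hf.isFiniteMeasure hγ
  have h1 : ∫ _, γ ∂ν ≤ ∫ x, f x ∂ν := by
    refine integral_mono_ae (integrable_const _) hf.integrable ?_
    filter_upwards [hf.mem_range] with x hx using hx.1
  rw [hf.normalized, integral_const, smul_eq_mul] at h1
  rwa [le_div_iff₀ hγ]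

theorem one_le_real_univ (hf : IsDensity ν γ f) (hγ : 0 < γ) : 1 ≤ ν.real Set.univ := by
  have := hf.isFiniteMeasure hγ
  have h1 : ∫ x, f x ∂ν ≤ ∫ _, 1 ∂ν := by
    refine integral_mono_ae hf.integrable (integrable_const _) ?_
    filter_upwards [hf.mem_range] with x hx using hx.2
  rwa [hf.normalized, integral_const, smul_eq_mul, mul_one] at h1

theorem integrable_mul_log_div (hγ : 0 < γ) (hf : IsDensity ν γ f) (hg : IsDensity ν γ g)
    (hh : IsDensity ν γ h) : Integrable (fun x => f x * Real.log (g x / h x)) ν := by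
  have := hf.isFiniteMeasure hγ
  refine Integrable.of_bound (C := 2 * (1 / γ - 1)) (hf.aemeasurable.mul
    (Real.measurable_log.comp_aemeasurable
      (hg.aemeasurable.div hh.aemeasurable))).aestronglyMeasurable ?_
  filter_upwards [hf.mem_range, hg.mem_range, hh.mem_range] with x hfx hgx hhx
  have h1 := abs_log_le hγ hgx
  have h2 := abs_log_le hγ hhx
  rw [Real.norm_eq_abs, abs_mul, Real.log_div (hγ.trans_le hgx.1).ne' (hγ.trans_le hhx.1).ne',
    abs_of_pos (hγ.trans_le hfx.1)]
  have h3 := abs_sub (Real.log (g x)) (Real.log (h x))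
  have h4 := mul_le_of_le_one_left (abs_nonneg (Real.log (g x) - Real.log (h x))) hfx.2
  linarith

theorem integrable_mul_sub_div {w : α → ℝ} (hγ : 0 < γ) (hw : IsDensity ν γ w)
    (hf : IsDensity ν γ f) (hg : IsDensity ν γ g) :
    Integrable (fun x => w x * ((f x - g x) / g x)) ν := by
  have := hf.isFiniteMeasure hγ
  refine Integrable.of_bound (C := 1 / γ) (hw.aemeasurable.mul
    ((hf.aemeasurable.sub hg.aemeasurable).div hg.aemeasurable)).aestronglyMeasurable ?_
  filter_upwards [hw.mem_range, hf.mem_range, hg.mem_range] with x hwx hfx hgx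
  rw [Real.norm_eq_abs, abs_mul, abs_div, abs_of_pos (hγ.trans_le hwx.1),
    abs_of_pos (hγ.trans_le hgx.1)]
  have h1 : |f x - g x| / g x ≤ 1 / γ := div_le_div₀ one_pos.le (abs_sub_le_one hγ hfx hgx) hγ hgx.1
  have h2 : 0 ≤ |f x - g x| / g x := div_nonneg (abs_nonneg _) (hγ.trans_le hgx.1).le
  exact (mul_le_of_le_one_left h2 hwx.2).trans h1

theorem integrable_sq_sub (hγ : 0 < γ) (hf : IsDensity ν γ f) (hg : IsDensity ν γ g) :
    Integrable (fun x => (f x - g x) ^ 2) ν := by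
  have := hf.isFiniteMeasure hγ
  refine Integrable.of_bound (C := 1)
    ((hf.aemeasurable.sub hg.aemeasurable).pow_const 2).aestronglyMeasurable ?_
  filter_upwards [hf.mem_range, hg.mem_range] with x hfx hgx
  rw [Real.norm_eq_abs, abs_pow]
  exact pow_le_one₀ (abs_nonneg _) (abs_sub_le_one hγ hfx hgx)

theorem integrable_abs_sub (hf : IsDensity ν γ f) (hg : IsDensity ν γ g) :
    Integrable (fun x => |f x - g x|) ν :=
  (hf.integrable.sub hg.integrable).abs

theorem integrable_weighted_itakuraSaito {w : α → ℝ} (hγ : 0 < γ) (hw : IsDensity ν γ w)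
    (hf : IsDensity ν γ f) (hg : IsDensity ν γ g) :
    Integrable (fun x => (g x - w x) * (f x / g x - Real.log (f x / g x) - 1)) ν := by
  have h1 := (((integrable_mul_sub_div hγ hg hf hg).sub (integrable_mul_sub_div hγ hw hf hg)).sub
    (integrable_mul_log_div hγ hg hf hg)).add (integrable_mul_log_div hγ hw hf hg)
  refine h1.congr ?_
  filter_upwards [hg.mem_range] with x hgx
  have : g x ≠ 0 := (hγ.trans_le hgx.1).ne'
  simp only [Pi.add_apply, Pi.sub_apply]
  field_simp
  ring

/-- First-order optimality of the population minimizer. -/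
theorem integral_mul_sub_div_nonpos {w q : α → ℝ} (hγ : 0 < γ) (hw : IsDensity ν γ w)
    (hq : IsDensity ν γ q) (hf : IsDensity ν γ f)
    (hmin : ∀ θ : ℝ, 0 < θ → θ ≤ 1 → IsDensity ν γ (fun x => q x + θ * (f x - q x)) ∧
      ∫ x, w x * Real.log (w x / q x) ∂ν ≤
        ∫ x, w x * Real.log (w x / (q x + θ * (f x - q x))) ∂ν) :
    ∫ x, w x * ((f x - q x) / q x) ∂ν ≤ 0 := by
  have := hf.isFiniteMeasure hγ
  set I := ∫ x, w x * ((f x - q x) / q x) ∂ν with hI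
  set c : ℝ := ν.real Set.univ * (1 / γ ^ 2) with hc
  have hc0 : 0 ≤ c := by positivity
  have hIi := integrable_mul_sub_div hγ hw hf hq
  have hQi := integrable_mul_log_div hγ hw hw hq
  have key : ∀ θ : ℝ, 0 < θ → θ ≤ 1 → I ≤ θ * c := by
    intro θ hθ hθ1
    obtain ⟨hd, hle⟩ := hmin θ hθ hθ1
    have h1 : ∫ x, w x * Real.log (w x / (q x + θ * (f x - q x))) ∂ν ≤
        ∫ x, (w x * Real.log (w x / q x) - θ * (w x * ((f x - q x) / q x))
          + θ ^ 2 * (1 / γ ^ 2)) ∂ν := by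
      refine integral_mono_ae (integrable_mul_log_div hγ hw hw hd)
        ((hQi.sub (hIi.const_mul θ)).add (integrable_const _)) ?_
      filter_upwards [hw.mem_range, hq.mem_range, hf.mem_range] with x h1 h2 h3
      exact mul_log_div_perturb_le hγ h1 h2 h3 hθ hθ1
    rw [integral_add (f := fun x => w x * Real.log (w x / q x) - θ * (w x * ((f x - q x) / q x)))
      (hQi.sub (hIi.const_mul θ)) (integrable_const _), integral_sub hQi (hIi.const_mul θ),
      integral_const_mul, ← hI, integral_const, smul_eq_mul] at h1
    have h2 : θ * I ≤ θ * (θ * c) := by rw [hc]; linarith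
    exact le_of_mul_le_mul_left h2 hθ
  by_contra! hcon
  -- If `I` were positive, this `θ` would give `I ≤ I/2`.
  have h1 := key (min 1 (I / (2 * (c + 1)))) (lt_min one_pos (by positivity)) (min_le_left _ _)
  have h2 : min 1 (I / (2 * (c + 1))) * c ≤ I / (2 * (c + 1)) * c :=
    mul_le_mul_of_nonneg_right (min_le_right _ _) hc0
  have h3 : I / (2 * (c + 1)) * c = I / 2 * (c / (c + 1)) := by field_simp
  have h4 : c / (c + 1) ≤ 1 := (div_le_one (by positivity)).2 (by linarith)
  nlinarith

end IsDensity

theorem sq_integral_abs_le {α : Type*} [MeasurableSpace α] {ν : Measure α} [IsFiniteMeasure ν]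
    {g : α → ℝ} (hg : Integrable g ν) (hg2 : Integrable (fun x => g x ^ 2) ν) :
    (∫ x, |g x| ∂ν) ^ 2 ≤ ν.real Set.univ * ∫ x, g x ^ 2 ∂ν := by
  set I := ∫ x, |g x| ∂ν with hI
  set V := ν.real Set.univ with hV
  have hV0 : 0 ≤ V := measureReal_nonneg
  -- Cauchy–Schwarz as a variance: the expanded integral is `V (V ∫ g² - I²)`.
  have h1 : 0 ≤ ∫ x, (V * |g x| - I) ^ 2 ∂ν := integral_nonneg fun x => sq_nonneg _
  have h2 : (fun x => (V * |g x| - I) ^ 2) =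
      fun x => V ^ 2 * g x ^ 2 - 2 * V * I * |g x| + I ^ 2 := by
    funext x; rw [sub_sq, mul_pow, sq_abs]; ring
  rw [h2, integral_add (f := fun x => V ^ 2 * g x ^ 2 - 2 * V * I * |g x|)
    ((hg2.const_mul _).sub (hg.abs.const_mul _)) (integrable_const _),
    integral_sub (hg2.const_mul _) (hg.abs.const_mul _), integral_const_mul, integral_const_mul,
    ← hI, integral_const, smul_eq_mul, ← hV] at h1
  rcases hV0.eq_or_lt with h | h
  · have h3 : ν = 0 := by
      have : ν Set.univ = 0 := by
        rw [← measureReal_eq_zero_iff]; exact h.symm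
      exact Measure.measure_univ_eq_zero.1 this
    simp [hI, h3]
  · have h3 : 0 ≤ V * (V * ∫ x, g x ^ 2 ∂ν - I ^ 2) := by nlinarith
    have := nonneg_of_mul_nonneg_right h3 h
    linarith

namespace IsDensity

variable {α : Type*} [MeasurableSpace α] {ν : Measure α} {γ : ℝ} {f g p q w s : α → ℝ}

/-- A Pinsker type inequality. -/
theorem integral_abs_sub_le_sqrt (hγ : 0 < γ) (hf : IsDensity ν γ f) (hg : IsDensity ν γ g) :
    ∫ x, |f x - g x| ∂ν ≤ 2 / γ * Real.sqrt (∫ x, f x * Real.log (f x / g x) ∂ν) := by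
  have := hf.isFiniteMeasure hγ
  have hi := integrable_mul_log_div hγ hf hf hg
  have h2 := integrable_sq_sub hγ hf hg
  have h1 : ∫ x, (f x - g x) ^ 2 / 4 ∂ν ≤ ∫ x, (f x * Real.log (f x / g x) - f x + g x) ∂ν := by
    refine integral_mono_ae (h2.div_const 4) ((hi.sub hf.integrable).add hg.integrable) ?_
    filter_upwards [hf.mem_range, hg.mem_range] with x hfx hgx
    have hf0 := hγ.trans_le hfx.1
    have hg0 := hγ.trans_le hgx.1
    rw [Real.log_div hf0.ne' hg0.ne']
    exact quarter_sq_sub_le_mul_log hf0 hfx.2 hg0 hgx.2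
  rw [integral_add (f := fun x => f x * Real.log (f x / g x) - f x) (hi.sub hf.integrable)
    hg.integrable, integral_sub hi hf.integrable, hf.normalized, hg.normalized,
    integral_div] at h1
  set D := ∫ x, f x * Real.log (f x / g x) ∂ν
  have h3 := sq_integral_abs_le (hf.integrable.sub hg.integrable) h2
  simp only [Pi.sub_apply] at h3
  have h4 := hf.real_univ_le hγ
  have hγ1 : γ ≤ 1 := by
    have := hf.one_le_real_univ hγ
    have : 1 ≤ 1 / γ := this.trans h4
    rwa [le_div_iff₀ hγ, one_mul] at this
  have hJ : 0 ≤ ∫ x, (f x - g x) ^ 2 ∂ν := integral_nonneg fun x => sq_nonneg _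
  have hD : 0 ≤ D := by linarith
  refine (pow_le_pow_iff_left₀ (integral_nonneg fun x => abs_nonneg _) (by positivity)
    two_ne_zero).1 ?_
  rw [mul_pow, Real.sq_sqrt hD]
  have h5 : ν.real Set.univ * ∫ x, (f x - g x) ^ 2 ∂ν ≤ 1 / γ * (4 * D) :=
    mul_le_mul h4 (by linarith) hJ (by positivity)
  have h6 : 1 / γ * (4 * D) = γ * ((2 / γ) ^ 2 * D) := by field_simp; ring
  have h7 : γ * ((2 / γ) ^ 2 * D) ≤ (2 / γ) ^ 2 * D := mul_le_of_le_one_left (by positivity) hγ1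
  linarith

/-- The population inequality. -/
theorem pythagorean_le (hγ : 0 < γ) (hw : IsDensity ν γ w) (hq : IsDensity ν γ q)
    (hp : IsDensity ν γ p) (hs : IsDensity ν γ s)
    (hopt : ∫ x, w x * ((s x - q x) / q x) ∂ν ≤ 0)
    (hwis : ∫ x, (q x - w x) * (p x / q x - Real.log (p x / q x) - 1) ∂ν ≤ 0) :
    (∫ x, q x * Real.log (q x / p x) ∂ν) + ∫ x, w x * Real.log (w x / q x) ∂ν ≤
      (∫ x, w x * Real.log (w x / p x) ∂ν) + 1 / γ * ∫ x, |s x - p x| ∂ν := by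
  have i1 := integrable_mul_log_div hγ hq hq hp
  have i2 := integrable_mul_log_div hγ hw hw hq
  have i3 := integrable_mul_log_div hγ hw hw hp
  have i4 := integrable_weighted_itakuraSaito hγ hw hp hq
  have i5 := hq.integrable.sub hp.integrable
  have i6 := integrable_mul_sub_div hγ hw hs hq
  have i7 := (integrable_abs_sub hs hp).const_mul (1 / γ)
  have key := integral_mono_ae (i1.add i2) ((((i3.add i4).add i5).add i6).add i7) (by
    filter_upwards [hw.mem_range, hq.mem_range, hp.mem_range] with x h1 h2 h3
    exact pythagorean_pointwise hγ h1 h2 h3)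
  rw [integral_add' i1 i2, integral_add' (((i3.add i4).add i5).add i6) i7,
    integral_add' ((i3.add i4).add i5) i6, integral_add' (i3.add i4) i5, integral_add' i3 i4,
    integral_sub' hq.integrable hp.integrable, hq.normalized, hp.normalized,
    integral_const_mul] at key
  linarith

theorem divergence_lipschitz (hγ : 0 < γ) (hf : IsDensity ν γ f) (hq : IsDensity ν γ q)
    (hp : IsDensity ν γ p) (hw : IsDensity ν γ w) :
    (∫ x, f x * Real.log (f x / p x) ∂ν) + ∫ x, w x * Real.log (w x / f x) ∂ν ≤
      (∫ x, q x * Real.log (q x / p x) ∂ν) + (∫ x, w x * Real.log (w x / q x) ∂ν)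
        + 2 / γ * ∫ x, |f x - q x| ∂ν := by
  have i1 := integrable_mul_log_div hγ hf hf hp
  have i2 := integrable_mul_log_div hγ hw hw hf
  have i3 := integrable_mul_log_div hγ hq hq hp
  have i4 := integrable_mul_log_div hγ hw hw hq
  have i5 := (integrable_abs_sub hf hq).const_mul (2 / γ)
  have key := integral_mono_ae (i1.add i2) ((i3.add i4).add i5) (by
    filter_upwards [hf.mem_range, hq.mem_range, hp.mem_range, hw.mem_range] with x h1 h2 h3 h4
    exact mul_log_div_lipschitz hγ h1 h2 h3 h4)
  rw [integral_add' i1 i2, integral_add' (i3.add i4) i5, integral_add' i3 i4,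
    integral_const_mul] at key
  exact key

end IsDensity

/-! ### The fast rate for the empirical minimizer -/

/-- The net cardinality is absorbed by `4 * 17 ^ k ≤ 68 ^ C ≤ exp (5 * C)`; `C ≠ 0` is needed for
the factor 4. -/
theorem four_mul_pow_mul_exp_le {k C : ℕ} (hk : k ≤ C) (hC : C ≠ 0) {δ : ℝ} (hδ : 0 < δ) :
    4 * 17 ^ k * Real.exp (-(5 * C + Real.log (1 / δ))) ≤ δ := by
  have h1 : (4 : ℝ) * 17 ^ k ≤ 68 ^ C := by
    have h2 : (17 : ℝ) ^ k ≤ 17 ^ C := pow_le_pow_right₀ (by norm_num) hk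
    have h3 : (4 : ℝ) ≤ 4 ^ C := le_self_pow₀ (by norm_num) hC
    calc (4 : ℝ) * 17 ^ k ≤ 4 ^ C * 17 ^ C := by gcongr
      _ = 68 ^ C := by rw [← mul_pow]; norm_num
  have h2 : (68 : ℝ) ^ C ≤ Real.exp (5 * C) := by
    have h3 : (68 : ℝ) ≤ Real.exp 5 := by
      have h4 : Real.exp 5 = Real.exp 1 ^ 5 := by rw [← Real.exp_nat_mul]; norm_num
      have h5 : (2.7 : ℝ) ^ 5 ≤ Real.exp 1 ^ 5 :=
        pow_le_pow_left₀ (by norm_num) (by linarith [Real.exp_one_gt_d9]) 5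
      rw [h4]
      exact le_trans (by norm_num) h5
    rw [mul_comm, Real.exp_nat_mul]
    exact pow_le_pow_left₀ (by norm_num) h3 C
  rw [neg_add, Real.exp_add, one_div, Real.log_inv, neg_neg, Real.exp_log hδ, Real.exp_neg,
    ← mul_assoc]
  refine mul_le_of_le_one_left hδ.le ?_
  rw [← div_eq_mul_inv]
  exact (div_le_one (Real.exp_pos _)).2 (h1.trans h2)

variable {d ds n : ℕ} {X : Set (EuclideanSpace ℝ (Fin d))} {γ : ℝ}

theorem IsOutputDistribution.isDensity {F : EuclideanSpace ℝ (Fin d) → ℝ} (hX : MeasurableSet X)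
    (hF : IsOutputDistribution X γ F) : IsDensity (volume.restrict X) γ F :=
  ⟨hF.aemeasurable, ae_restrict_of_forall_mem hX hF.mem_range, hF.normalized⟩

theorem ae_sampleLaw_mem (hX : MeasurableSet X) [IsProbabilityMeasure (ProbabilityTheory.cond
    (volume : Measure (EuclideanSpace ℝ (Fin d))) X)] :
    ∀ᵐ x ∂(sampleLaw X n), ∀ i, x i ∈ X := by
  rw [ae_all_iff]
  intro i
  exact (Measure.tendsto_eval_ae_ae (i := i)).eventually (ProbabilityTheory.ae_cond_mem hX)

/-- The restrictions to `X` of the functions `c ∘ hs`, as a linear family. -/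
noncomputable def restrictedFamily (X : Set (EuclideanSpace ℝ (Fin d)))
    (hs : EuclideanSpace ℝ (Fin d) → EuclideanSpace ℝ (Fin ds))
    (U : Submodule ℝ (EuclideanSpace ℝ (Fin ds) → ℝ)) :
    U →ₗ[ℝ] EuclideanSpace ℝ (Fin d) → ℝ where
  toFun c := X.indicator ((c : EuclideanSpace ℝ (Fin ds) → ℝ) ∘ hs)
  map_add' u v := by
    rw [← Set.indicator_add']
    rfl
  map_smul' r u := Set.indicator_const_smul X r _

theorem isBoundedFamily_restrictedFamily (hX : MeasurableSet X)
    {hs : EuclideanSpace ℝ (Fin d) → EuclideanSpace ℝ (Fin ds)}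
    {S : Set (EuclideanSpace ℝ (Fin ds) → ℝ)}
    (hS : ∀ f ∈ S, AEMeasurable (f ∘ hs) (volume.restrict X))
    (hb : ∀ f ∈ S, ∃ b, ∀ x ∈ X, |f (hs x)| ≤ b) :
    IsBoundedFamily (ProbabilityTheory.cond volume X)
      (restrictedFamily X hs (Submodule.span ℝ S)) := by
  constructor
  · rintro ⟨c, hc⟩
    refine AEMeasurable.mono_ac ((aemeasurable_indicator_iff hX).2 (?_ :
      AEMeasurable (c ∘ hs) (volume.restrict X))) ProbabilityTheory.cond_absolutelyContinuous
    induction hc using Submodule.span_induction with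
    | mem f hf => exact hS f hf
    | zero => exact aemeasurable_const
    | add u v _ _ hu hv => exact hu.add hv
    | smul r u _ hu => exact hu.const_mul r
  · rintro ⟨c, hc⟩
    suffices h : ∃ b, ∀ x ∈ X, |c (hs x)| ≤ b by
      obtain ⟨b, hb⟩ := h
      refine ⟨|b|, fun x => ?_⟩
      by_cases hx : x ∈ X
      · simpa [restrictedFamily, hx] using (hb x hx).trans (le_abs_self b)
      · simp [restrictedFamily, hx]
    induction hc using Submodule.span_induction with
    | mem f hf => exact hb f hf
    | zero => exact ⟨0, fun x _ => by simp⟩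
    | add u v _ _ hu hv =>
      obtain ⟨b, hb⟩ := hu
      obtain ⟨b', hb'⟩ := hv
      exact ⟨b + b', fun x hx => (abs_add_le _ _).trans (add_le_add (hb x hx) (hb' x hx))⟩
    | smul r u _ hu =>
      obtain ⟨b, hb⟩ := hu
      refine ⟨|r| * b, fun x hx => ?_⟩
      rw [Pi.smul_apply, smul_eq_mul, abs_mul]
      exact mul_le_mul_of_nonneg_left (hb x hx) (abs_nonneg r)

theorem integral_cond_eq (X : Set (EuclideanSpace ℝ (Fin d)))
    (g : EuclideanSpace ℝ (Fin d) → ℝ) :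
    ∫ x, g x ∂(ProbabilityTheory.cond volume X) = (volume.real X)⁻¹ * ∫ x in X, g x := by
  rw [ProbabilityTheory.cond, integral_smul_measure, ENNReal.toReal_inv, smul_eq_mul]
  rfl

/-- First-order optimality over a convex hypothesis class. -/
theorem integral_mul_sub_div_nonpos_of_isArgmin (hγ : 0 < γ) (hX : MeasurableSet X)
    {Fw : EuclideanSpace ℝ (Fin d) → ℝ}
    {hs : EuclideanSpace ℝ (Fin d) → EuclideanSpace ℝ (Fin ds)}
    (hFw : IsOutputDistribution X γ Fw)
    {𝓕 : Set (EuclideanSpace ℝ (Fin ds) → ℝ)} (hconv : Convex ℝ 𝓕)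
    (h𝓕 : ∀ f ∈ 𝓕, IsOutputDistribution X γ (f ∘ hs)) {fsw : EuclideanSpace ℝ (Fin ds) → ℝ}
    (hfsw : IsArgmin 𝓕 (fun f => outputDivergence X Fw (f ∘ hs)) fsw)
    {f : EuclideanSpace ℝ (Fin ds) → ℝ} (hf : f ∈ 𝓕) :
    ∫ x in X, Fw x * ((f (hs x) - fsw (hs x)) / fsw (hs x)) ≤ 0 := by
  refine IsDensity.integral_mul_sub_div_nonpos (q := fsw ∘ hs) (f := f ∘ hs) hγ (hFw.isDensity hX)
    ((h𝓕 _ hfsw.1).isDensity hX) ((h𝓕 _ hf).isDensity hX) fun θ hθ hθ1 => ?_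
  have hmem : fsw + θ • (f - fsw) ∈ 𝓕 := hconv.add_smul_sub_mem hfsw.1 hf ⟨hθ.le, hθ1⟩
  exact ⟨(h𝓕 _ hmem).isDensity hX, hfsw.2 _ hmem⟩

/-- The fast rate for empirical minimizers over a convex class of finite pseudo-dimension. -/
theorem exists_integral_abs_sub_le (hγ : 0 < γ) (hX : MeasurableSet X)
    {Fw : EuclideanSpace ℝ (Fin d) → ℝ}
    {hs : EuclideanSpace ℝ (Fin d) → EuclideanSpace ℝ (Fin ds)}
    (hFw : IsOutputDistribution X γ Fw)
    {𝓕 : Set (EuclideanSpace ℝ (Fin ds) → ℝ)} (hconv : Convex ℝ 𝓕)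
    (h𝓕 : ∀ f ∈ 𝓕, IsOutputDistribution X γ (f ∘ hs))
    {C : ℕ} (hC : pseudoDimension 𝓕 = (C : ℕ∞)) {fsw : EuclideanSpace ℝ (Fin ds) → ℝ}
    (hfsw : IsArgmin 𝓕 (fun f => outputDivergence X Fw (f ∘ hs)) fsw)
    (hn : 0 < n) {δ : ℝ} (hδ : 0 < δ) (hδ1 : δ < 1) :
    ∃ bad : Set (Fin n → EuclideanSpace ℝ (Fin d)), sampleLaw X n bad ≤ ENNReal.ofReal δ ∧
      ∀ x ∉ bad, ∀ fhat : EuclideanSpace ℝ (Fin ds) → ℝ,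
        IsArgmin 𝓕 (fun f => empiricalDivergence x Fw (f ∘ hs)) fhat →
        ∫ x in X, |fhat (hs x) - fsw (hs x)| ≤
          1 / γ * ((1 + 32 / γ ^ 2) * (16 * Real.sqrt ((5 * C + Real.log (1 / δ)) / n))) := by
  have hn' : (0 : ℝ) < n := by exact_mod_cast hn
  have hL : 0 < Real.log (1 / δ) := Real.log_pos (by rw [lt_div_iff₀ hδ]; linarith)
  have hwd := hFw.isDensity hX
  have hqd := (h𝓕 _ hfsw.1).isDensity hX
  have hfin := hwd.isFiniteMeasure hγ
  have hV1 : 1 ≤ volume.real X := by simpa using hwd.one_le_real_univ hγ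
  have hV2 : volume.real X ≤ 1 / γ := by simpa using hwd.real_univ_le hγ
  have hX0 : volume X ≠ 0 := fun h => by
    rw [measureReal_def, h] at hV1; norm_num at hV1
  have hXtop : volume X ≠ ⊤ := fun h => by
    rw [measureReal_def, h] at hV1; norm_num at hV1
  have hprob : IsProbabilityMeasure (ProbabilityTheory.cond
      (volume : Measure (EuclideanSpace ℝ (Fin d))) X) :=
    ProbabilityTheory.cond_isProbabilityMeasure_of_finite hX0 hXtop
  set S := (fun f => f - fsw) '' 𝓕 with hS
  obtain ⟨hfd, hrank⟩ := finiteDimensional_span_sub_of_convex hconv hC hfsw.1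
  rw [← hS] at hfd hrank
  have hmemS : ∀ f ∈ 𝓕, f - fsw ∈ Submodule.span ℝ S := fun f hf =>
    Submodule.subset_span ⟨f, hf, rfl⟩
  -- In pseudo-dimension zero the class is a single function and there is nothing to estimate.
  rcases eq_or_ne C 0 with rfl | hC0
  · refine ⟨∅, by simp, fun x _ fhat hfhat => ?_⟩
    have h0 : Submodule.span ℝ S = ⊥ := Submodule.finrank_eq_zero.1 (Nat.le_zero.1 hrank)
    have h1 := hmemS fhat hfhat.1
    rw [h0, Submodule.mem_bot, sub_eq_zero] at h1
    rw [h1]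
    simp only [sub_self, abs_zero, integral_zero]
    positivity
  have hΦ : IsBoundedFamily (ProbabilityTheory.cond volume X)
      (restrictedFamily X hs (Submodule.span ℝ S)) := by
    refine isBoundedFamily_restrictedFamily hX ?_ ?_
    · rintro _ ⟨f, hf, rfl⟩
      exact (h𝓕 f hf).aemeasurable.sub (h𝓕 _ hfsw.1).aemeasurable
    · rintro _ ⟨f, hf, rfl⟩
      exact ⟨1, fun x hx => abs_sub_le_one hγ ((h𝓕 f hf).mem_range x hx)
        ((h𝓕 _ hfsw.1).mem_range x hx)⟩
  have ha : AEMeasurable (X.indicator fun x => Fw x / fsw (hs x))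
      (ProbabilityTheory.cond volume X) :=
    ((aemeasurable_indicator_iff hX).2 (hFw.aemeasurable.div
      (h𝓕 _ hfsw.1).aemeasurable)).mono_ac ProbabilityTheory.cond_absolutelyContinuous
  have hA : ∀ x, |X.indicator (fun x => Fw x / fsw (hs x)) x| ≤ 1 / γ := by
    intro x
    by_cases hx : x ∈ X
    · obtain ⟨h1, h2⟩ := weight_div_mem hγ (hFw.mem_range x hx) ((h𝓕 _ hfsw.1).mem_range x hx)
      rw [Set.indicator_of_mem hx]
      exact (abs_of_pos h1).trans_le h2
    · rw [Set.indicator_of_notMem hx, abs_zero]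
      positivity
  -- Chosen so that the exponent `n * ρ ^ 2 / 256` is exactly `5 * C + log (1/δ)`.
  set ρ := 16 * Real.sqrt ((5 * C + Real.log (1 / δ)) / n) with hρ
  have hρ0 : 0 < ρ := by positivity
  have hρn : n * ρ ^ 2 / 256 = 5 * C + Real.log (1 / δ) := by
    rw [hρ, mul_pow, Real.sq_sqrt (by positivity)]
    field_simp
    norm_num
  obtain ⟨bad, hbad, hgood⟩ := hΦ.exists_lpNorm_le ha (one_div_pos.2 hγ) hA hρ0 hn
  rw [hρn] at hbad
  refine ⟨bad ∪ {x | ¬ ∀ i, x i ∈ X}, ?_, ?_⟩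
  · refine (measure_union_le _ _).trans ?_
    have h1 : sampleLaw X n {x | ¬ ∀ i, x i ∈ X} = 0 := ae_sampleLaw_mem hX
    rw [h1, add_zero]
    exact hbad.trans (ENNReal.ofReal_le_ofReal (four_mul_pow_mul_exp_le hrank hC0 hδ))
  intro x hx fhat hfhat
  simp only [Set.mem_union, Set.mem_ofPred_eq, not_or, not_not] at hx
  obtain ⟨hxb, hxX⟩ := hx
  set c : Submodule.span ℝ S := ⟨fhat - fsw, hmemS fhat hfhat.1⟩ with hc
  have hΦX : ∀ z ∈ X, restrictedFamily X hs (Submodule.span ℝ S) c z =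
      fhat (hs z) - fsw (hs z) := fun z hz => Set.indicator_of_mem hz _
  have hΦ1 : ∀ z, |restrictedFamily X hs (Submodule.span ℝ S) c z| ≤ 1 := by
    intro z
    by_cases hz : z ∈ X
    · rw [hΦX z hz]
      exact abs_sub_le_one hγ ((h𝓕 _ hfhat.1).mem_range z hz) ((h𝓕 _ hfsw.1).mem_range z hz)
    · have : restrictedFamily X hs (Submodule.span ℝ S) c z = 0 := Set.indicator_of_notMem hz _
      rw [this, abs_zero]
      exact zero_le_one
  -- The modulus `γ / 4` is that of `mul_log_div_strongly_convex`.
  have hr := hgood x hxb c hΦ1 (γ / 4) (by positivity) ?_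
  · have hfd := (h𝓕 _ hfhat.1).isDensity hX
    have h1 : 8 * (1 / γ) / (γ / 4) = 32 / γ ^ 2 := by field_simp; norm_num
    rw [h1] at hr
    set r := lpNorm (restrictedFamily X hs (Submodule.span ℝ S) c) 2
      (ProbabilityTheory.cond volume X) with hrdef
    have hr0 : 0 ≤ r := lpNorm_nonneg
    have h2 : r ^ 2 = (volume.real X)⁻¹ * ∫ z in X, (fhat (hs z) - fsw (hs z)) ^ 2 := by
      rw [hrdef, sq_lpNorm_two (hΦ.aemeasurable c), integral_cond_eq]
      congr 1
      exact setIntegral_congr_fun hX fun z hz => by simp only [hΦX z hz]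
    have h3 := sq_integral_abs_le (hfd.integrable.sub hqd.integrable)
      (IsDensity.integrable_sq_sub hγ hfd hqd)
    simp only [Pi.sub_apply, Function.comp_apply, measureReal_restrict_apply_univ] at h3
    have h4 : ∫ z in X, |fhat (hs z) - fsw (hs z)| ≤ volume.real X * r := by
      refine (pow_le_pow_iff_left₀ (integral_nonneg fun x => abs_nonneg _) (by positivity)
        two_ne_zero).1 (h3.trans (le_of_eq ?_))
      rw [mul_pow, h2]
      field_simp
    refine h4.trans (mul_le_mul hV2 hr hr0 (by positivity))
  · have hopt := integral_mul_sub_div_nonpos_of_isArgmin hγ hX hFw hconv h𝓕 hfsw hfhat.1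
    have h1 : ∫ z, X.indicator (fun x => Fw x / fsw (hs x)) z *
        restrictedFamily X hs (Submodule.span ℝ S) c z ∂(ProbabilityTheory.cond volume X) ≤ 0 := by
      rw [integral_cond_eq]
      refine mul_nonpos_of_nonneg_of_nonpos (by positivity) (le_of_eq_of_le ?_ hopt)
      refine setIntegral_congr_fun hX fun z hz => ?_
      simp only [hΦX z hz, Set.indicator_of_mem hz]
      ring
    have h2 : ∑ i, γ / 4 * (restrictedFamily X hs (Submodule.span ℝ S) c (x i) *
        restrictedFamily X hs (Submodule.span ℝ S) c (x i)) ≤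
        ∑ i, X.indicator (fun x => Fw x / fsw (hs x)) (x i) *
          restrictedFamily X hs (Submodule.span ℝ S) c (x i) := by
      -- Empirical optimality against `fsw` cancels the divergences in the strong convexity bound,
      -- leaving the second moment below the linear term. As the population mean of that term is
      -- nonpositive, its deviation is at least as large.
      have h3 := hfhat.2 fsw hfsw.1
      simp only [empiricalDivergence, Function.comp_apply] at h3
      have h4 := Finset.sum_le_sum fun i (_ : i ∈ Finset.univ) =>
        mul_log_div_strongly_convex hγ (hFw.mem_range _ (hxX i))
          ((h𝓕 _ hfsw.1).mem_range _ (hxX i)) ((h𝓕 _ hfhat.1).mem_range _ (hxX i))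
      simp only [Function.comp_apply, Finset.sum_add_distrib, Finset.sum_sub_distrib] at h4
      simp only [hΦX _ (hxX _), Set.indicator_of_mem (hxX _)]
      linarith
    rw [← Finset.mul_sum] at h2
    rw [empiricalDeviation, mul_div_assoc']
    have := div_le_div_of_nonneg_right h2 hn'.le
    linarith

end WeakToStrong

/-! ### Conclusion -/

theorem mainTheorem6 (γ : ℝ) (hγ : 0 < γ) :
    ∃ K : ℝ, 0 < K ∧
      ∀ (d ds : ℕ) (X : Set (EuclideanSpace ℝ (Fin d))), MeasurableSet X →
      -- the labeling function, the weak model and the strong representation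
      ∀ (Fstar Fw : EuclideanSpace ℝ (Fin d) → ℝ)
        (hs : EuclideanSpace ℝ (Fin d) → EuclideanSpace ℝ (Fin ds)),
      WeakToStrong.IsOutputDistribution X γ Fstar →
      WeakToStrong.IsOutputDistribution X γ Fw →
      -- the convex hypothesis class, with its complexity constant
      ∀ (𝓕 : Set (EuclideanSpace ℝ (Fin ds) → ℝ)),
      Convex ℝ 𝓕 →
      (∀ f ∈ 𝓕, WeakToStrong.IsOutputDistribution X γ (f ∘ hs)) →
      ∀ C : ℕ, WeakToStrong.pseudoDimension 𝓕 = (C : ℕ∞) →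
      -- the strong ceiling model and the population weak-to-strong model
      ∀ fs fsw : EuclideanSpace ℝ (Fin ds) → ℝ,
      WeakToStrong.IsArgmin 𝓕 (fun f => WeakToStrong.outputDivergence X Fstar (f ∘ hs)) fs →
      WeakToStrong.IsArgmin 𝓕 (fun f => WeakToStrong.outputDivergence X Fw (f ∘ hs)) fsw →
      WeakToStrong.weightedItakuraSaito X (fun x => fsw (hs x) - Fw x) Fstar (fsw ∘ hs) ≤ 0 →
      ∀ (n : ℕ), 0 < n → ∀ δ : ℝ, 0 < δ → δ < 1 →
      ∃ A : Set (Fin n → EuclideanSpace ℝ (Fin d)), MeasurableSet A ∧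
        ENNReal.ofReal (1 - δ) ≤ WeakToStrong.sampleLaw X n A ∧
        ∀ x ∈ A, ∀ fhat : EuclideanSpace ℝ (Fin ds) → ℝ,
          WeakToStrong.IsArgmin 𝓕
            (fun f => WeakToStrong.empiricalDivergence x Fw (f ∘ hs)) fhat →
          WeakToStrong.outputDivergence X (fhat ∘ hs) Fstar ≤
            WeakToStrong.outputDivergence X Fw Fstar
              - WeakToStrong.outputDivergence X Fw (fhat ∘ hs)
              + K * Real.sqrt (WeakToStrong.outputDivergence X (fs ∘ hs) Fstar)
              + K * Real.sqrt ((C : ℝ) / n)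
              + K * Real.sqrt (Real.log (1 / δ) / n) := by
  open WeakToStrong in
  -- The first `2 / γ` is the Lipschitz constant, `1 / γ` bounds the volume, `1 + 32 / γ ^ 2` comes
  -- from the localized bound, and 48 is 16 times the 3 from splitting the square root.
  refine ⟨2 / γ * (1 / γ * ((1 + 32 / γ ^ 2) * 48)), by positivity, ?_⟩
  intro d ds X hX Fstar Fw hs hstar hFw 𝓕 hconv h𝓕 C hC fs fsw hfs hfsw hwis n hn δ hδ hδ1
  have hn' : (0 : ℝ) < n := by exact_mod_cast hn
  have hL : 0 < Real.log (1 / δ) := Real.log_pos (by rw [lt_div_iff₀ hδ]; linarith)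
  obtain ⟨bad, hbad, hgood⟩ := exists_integral_abs_sub_le hγ hX hFw hconv h𝓕 hC hfsw hn hδ hδ1
  have hpd := hstar.isDensity hX
  have hwd := hFw.isDensity hX
  have hqd := (h𝓕 _ hfsw.1).isDensity hX
  have hsd := (h𝓕 _ hfs.1).isDensity hX
  have hprob : IsProbabilityMeasure (sampleLaw X n) := by
    have hV1 : 1 ≤ volume.real X := by simpa using hwd.one_le_real_univ hγ
    have hX0 : volume X ≠ 0 := fun h => by
      rw [measureReal_def, h] at hV1; norm_num at hV1
    have hXtop : volume X ≠ ⊤ := fun h => by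
      rw [measureReal_def, h] at hV1; norm_num at hV1
    have := ProbabilityTheory.cond_isProbabilityMeasure_of_finite hX0 hXtop
    unfold sampleLaw
    infer_instance
  -- The bad set need not be measurable; its measurable hull has the same measure.
  refine ⟨(toMeasurable (sampleLaw X n) bad)ᶜ, (measurableSet_toMeasurable _ _).compl, ?_, ?_⟩
  · rw [prob_compl_eq_one_sub (measurableSet_toMeasurable _ _), measure_toMeasurable,
      ENNReal.ofReal_sub _ hδ.le, ENNReal.ofReal_one]
    exact tsub_le_tsub_left hbad _
  intro x hx fhat hfhat
  have h1 := hgood x (fun h => hx (subset_toMeasurable _ _ h)) fhat hfhat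
  have hfd := (h𝓕 _ hfhat.1).isDensity hX
  have h2 := IsDensity.divergence_lipschitz hγ hfd hqd hpd hwd
  have h3 := IsDensity.pythagorean_le hγ hwd hqd hpd hsd
    (integral_mul_sub_div_nonpos_of_isArgmin hγ hX hFw hconv h𝓕 hfsw hfs.1) hwis
  have h4 := IsDensity.integral_abs_sub_le_sqrt hγ hsd hpd
  simp only [Function.comp_apply] at h2 h3 h4
  simp only [outputDivergence, Function.comp_apply]
  set ε := ∫ x in X, fs (hs x) * Real.log (fs (hs x) / Fstar x)
  have h5 : Real.sqrt ((5 * C + Real.log (1 / δ)) / n) ≤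
      3 * (Real.sqrt (C / n) + Real.sqrt (Real.log (1 / δ) / n)) := by
    refine Real.sqrt_le_iff.2 ⟨by positivity, ?_⟩
    have h6 : Real.sqrt ((C : ℝ) / n) ^ 2 = C / n := Real.sq_sqrt (by positivity)
    have h7 : Real.sqrt (Real.log (1 / δ) / n) ^ 2 = Real.log (1 / δ) / n :=
      Real.sq_sqrt (by positivity)
    have h8 : (5 * C + Real.log (1 / δ)) / n = 5 * (C / n) + Real.log (1 / δ) / n := by ring
    rw [mul_pow, add_sq, h6, h7, h8]
    have h9 : 0 ≤ Real.sqrt ((C : ℝ) / n) * Real.sqrt (Real.log (1 / δ) / n) := by positivity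
    have h10 : 0 ≤ (C : ℝ) / n := by positivity
    have h11 : 0 ≤ Real.log (1 / δ) / n := by positivity
    linarith
  have h6 : 2 / γ * ∫ x in X, |fhat (hs x) - fsw (hs x)| ≤
      2 / γ * (1 / γ * ((1 + 32 / γ ^ 2) * (16 * (3 * (Real.sqrt (C / n) +
        Real.sqrt (Real.log (1 / δ) / n)))))) := by
    refine mul_le_mul_of_nonneg_left (h1.trans ?_) (by positivity)
    gcongr
  have h7 : 1 / γ * ∫ x in X, |fs (hs x) - Fstar x| ≤
      2 / γ * (1 / γ * ((1 + 32 / γ ^ 2) * 48)) * Real.sqrt ε := by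
    refine (mul_le_mul_of_nonneg_left h4 (by positivity)).trans ?_
    rw [← mul_assoc]
    refine mul_le_mul_of_nonneg_right ?_ (Real.sqrt_nonneg _)
    have h8 : 0 ≤ 32 / γ ^ 2 := by positivity
    have h9 : 0 < 1 / γ * (2 / γ) := by positivity
    have h10 : 2 / γ * (1 / γ * ((1 + 32 / γ ^ 2) * 48)) =
      1 / γ * (2 / γ) * ((1 + 32 / γ ^ 2) * 48) := by ring
    rw [h10]
    exact le_mul_of_one_le_right h9.le (by linarith)
  linarith
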